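/- **Setting.** There are $n$ agents and $k$ identical goods, $1\le k\le n$: any set of at most $k$ agents can be served. The values $v_1,\dots,v_n\ge 0$ are independent, $v_i\sim F_i$, where the $F_i$ are arbitrary (not necessarily identical) distributions on $[0,\infty)$ with finite mean. A mechanism maps each profile of reported values to a (possibly random) feasible set of served agents and to non-negative payments; it is required to be Bayesian incentive compatible and interim individually rational for all values in $[0,\infty)$. Its *expected consumer surplus* is the expected total value of the served agents minus the expected total payment. The *optimal surplus* is $\mathbb E\big[\max_{|S|\le k}\sum_{i\in S}v_i\big]$. Let $\zeta(n)=\zeta(n,k)$, the *optimal omniscient approximation*, be the supremum over all such $(F_1,\dots,F_n)$ of the ratio of the optimal surplus to the optimal (supremal) expected consumer surplus of a mechanism (with $0/0=0$). **Theorem.** 1. For all integers $1\le k\le n$ and every $0<\epsilon\le 1$, $$\zeta(n,k)\;\le\;\frac{1}{1-\frac{1}{\sqrt{2\pi k}}}\,(1-\ln\epsilon)\Big(1+\Big[\frac nk-1\Big]\epsilon\Big).$$ 2. Let $k=k(n)\ge 1$ for all large $n$, with $k(n)=o(n)$ as $n\to\infty$. Then $\zeta(n,k(n))\le(1+o(1))\ln\frac{n}{k(n)}$,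 i.e. there is a sequence $\delta_n\to0$ with $\zeta(n,k(n))\le(1+\delta_n)\ln\frac{n}{k(n)}$ for all large $n$. 3. Let $1\le k(n)\le n$ for all large $n$, with $k(n)=\Theta(n)$. Then $\zeta(n,k(n))\le 2.27\,(1+o(1))\big(0.577+\ln\frac{n}{k(n)}\big)$, i.e. there is a sequence $\delta_n\to0$ with $\zeta(n,k(n))\le 2.27\,(1+\delta_n)\big(0.577+\ln\frac{n}{k(n)}\big)$ for all large $n$. -/

import Mathlib

open MeasureTheory Filter Topology Asymptotics
open scoped ENNReal NNReal

namespace Auction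

/-- A profile of non-negative values, one for each of the `n` agents. -/
abbrev Values (n : ℕ) : Type := Fin n → ℝ≥0

/-- The joint law of the value profile when the values are independent with marginals `F i`. -/
noncomputable def law {n : ℕ} (F : Fin n → ProbabilityMeasure ℝ≥0) : Measure (Values n) :=
  Measure.pi fun i => (F i : Measure ℝ≥0)

/-- A Bayesian incentive-compatible, interim individually rational (direct, possibly randomized)
mechanism for `n` agents with independent private values `v i ∼ F i`, in which exactly the sets
of agents in `P` can be served. Payments are non-negative: the mechanism may burn money but
cannot pay the agents. -/
structure Mechanism {n : ℕ} (F : Fin n → ProbabilityMeasure ℝ≥0)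
    (P : Finset (Finset (Fin n))) where
  /-- `outcome v S` is the probability that `S` is the set of served agents when the reported
  values are `v`. -/
  outcome : Values n → Finset (Fin n) → ℝ≥0
  /-- `pay v i` is the (expected) payment of agent `i` when the reported values are `v`. -/
  pay : Values n → Fin n → ℝ≥0
  measurable_outcome : ∀ S, Measurable fun v => outcome v S
  measurable_pay : ∀ i, Measurable fun v => pay v i
  outcome_feasible : ∀ v S, S ∉ P → outcome v S = 0
  outcome_sum : ∀ v, ∑ S, outcome v S = 1
  integrable_pay : ∀ i, Integrable (fun v => (pay v i : ℝ)) (law F)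
  /-- The interim payments, as functions of the agent's own report `r`, are well defined. -/
  integrable_interim : ∀ i (r : ℝ≥0),
    Integrable (fun v => (pay (Function.update v i r) i : ℝ)) (law F)
  /-- Bayesian incentive compatibility: an agent with value `t` cannot gain in expectation over
  the other agents' values by reporting `r`. -/
  incentiveCompatible : ∀ i (t r : ℝ≥0),
    ∫ v, ((t : ℝ) * (∑ S with i ∈ S, (outcome (Function.update v i r) S : ℝ))
        - (pay (Function.update v i r) i : ℝ)) ∂(law F)
      ≤ ∫ v, ((t : ℝ) * (∑ S with i ∈ S, (outcome (Function.update v i t) S : ℝ))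
        - (pay (Function.update v i t) i : ℝ)) ∂(law F)
  /-- Interim individual rationality. -/
  individuallyRational : ∀ i (t : ℝ≥0),
    0 ≤ ∫ v, ((t : ℝ) * (∑ S with i ∈ S, (outcome (Function.update v i t) S : ℝ))
        - (pay (Function.update v i t) i : ℝ)) ∂(law F)

/-- The expected consumer surplus of a mechanism: the expected total value of the served agents
minus the expected total payment. -/
noncomputable def Mechanism.consumerSurplus {n : ℕ} {F : Fin n → ProbabilityMeasure ℝ≥0}
    {P : Finset (Finset (Fin n))} (M : Mechanism F P) : ℝ :=
  ∫ v, (∑ S, (M.outcome v S : ℝ) * (∑ i ∈ S, (v i : ℝ)) - ∑ i, (M.pay v i : ℝ)) ∂(law F)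

/-- The optimal expected consumer surplus. -/
noncomputable def optConsumerSurplus {n : ℕ} (F : Fin n → ProbabilityMeasure ℝ≥0)
    (P : Finset (Finset (Fin n))) : ℝ≥0∞ :=
  ⨆ M : Mechanism F P, ENNReal.ofReal M.consumerSurplus

/-- The omniscient benchmark, i.e. the optimal expected surplus: the expected largest total value
of a feasible set of agents. -/
noncomputable def optSurplus {n : ℕ} (F : Fin n → ProbabilityMeasure ℝ≥0)
    (P : Finset (Finset (Fin n))) : ℝ≥0∞ :=
  ∫⁻ v, ((P.sup fun S => ∑ i ∈ S, v i : ℝ≥0) : ℝ≥0∞) ∂(law F)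

/-- The optimal omniscient approximation for the feasibility constraint `P`: the worst case, over
all product distributions with finite means, of the ratio of the optimal expected surplus to the
optimal expected consumer surplus. (Division in `ℝ≥0∞`: `0 / 0 = 0`, and `a / 0 = ∞` for
`a ≠ 0`.) -/
noncomputable def omniscientApprox {n : ℕ} (P : Finset (Finset (Fin n))) : ℝ≥0∞ :=
  ⨆ (F : Fin n → ProbabilityMeasure ℝ≥0)
    (_ : ∀ i, Integrable (fun x : ℝ≥0 => (x : ℝ)) (F i : Measure ℝ≥0)),
    optSurplus F P / optConsumerSurplus F P

/-- `k` identical goods: any set of at most `k` agents can be served. -/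
def identicalGoods (n k : ℕ) : Finset (Finset (Fin n)) :=
  Finset.univ.filter fun S => S.card ≤ k

/-- The optimal omniscient approximation with `n` agents and `k` identical goods. -/
noncomputable def zeta (n k : ℕ) : ℝ≥0∞ := omniscientApprox (identicalGoods n k)

end Auction

/-! Posting prices already gives a large enough consumer surplus, and only two comparisons are
needed.

Posted prices (`exists_mechanism`): if the expected number of agents accepting their prices is at
most `Λ * k`, serve up to `k` accepting agents, preferring those with the larger expected utility
given acceptance. In every superlevel set of this ranking the number of accepting agents is a sum of
independent Bernoulli variables, whose expected shortfall below `k` is at most the Poisson one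
(`integral_shortfall_le`). Convexity of the Poisson shortfall and a layer-cake sum show that the
fraction `soldFraction k Λ / Λ` of the utility of unrestricted offers survives.

Benchmark (`optSurplus_le`): if `q i` is the probability that the optimum serves `i`, then the
optimal surplus is at most `∑ i, ∫ min (tail i t) (q i) dt`, with `∑ q i ≤ k`. Raise `q i` to `r i =
ε + (1 - ε) q i`, whose sum is at most `c k` for `c = 1 + (n/k - 1) ε`. For `T ≤ 1`, `min T r` is
the integral over `l > 1` of `l⁻² T 1[T ≤ l r]` (`min_le_lintegral`), and `∫ T 1[T ≤ s] dt` is at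
most the utility of an offer accepted with probability at most `s` (`exists_price`). So the
benchmark is an `l⁻²`-weighted average of posted-price utilities with `Λ = l c`. As `r i ≥ ε`,
nothing changes beyond `l = 1/ε`, and `∫ l⁻² min l (1/ε) dl = 1 - log ε` is the logarithmic loss.

The three claims differ in the choice of `ε` and in the upper bound used for `(soldFraction k Λ)⁻¹`:
Stirling's formula for large `k`, and `1 + 2/Λ` uniformly in `k`. -/

namespace Auction

/-! ### Poisson probabilities and the expected shortfall -/

/-- The Poisson point probability. -/
noncomputable def poiPmf (m : ℕ) (μ : ℝ) : ℝ := Real.exp (-μ) * μ ^ m / m.factorial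

/-- The probability that a Poisson variable is smaller than `b`. -/
noncomputable def poiCdf (b : ℕ) (μ : ℝ) : ℝ := ∑ m ∈ Finset.range b, poiPmf m μ

/-- The expected shortfall of a Poisson variable below the level `a`. -/
noncomputable def poiShortfall (a : ℕ) (μ : ℝ) : ℝ := ∑ b ∈ Finset.range a, poiCdf (b + 1) μ

lemma poiPmf_nonneg (m : ℕ) {μ : ℝ} (hμ : 0 ≤ μ) : 0 ≤ poiPmf m μ := by
  unfold poiPmf; positivity

lemma succ_mul_poiPmf_succ (m : ℕ) (μ : ℝ) :
    ((m : ℝ) + 1) * poiPmf (m + 1) μ = μ * poiPmf m μ := by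
  unfold poiPmf
  rw [Nat.factorial_succ]
  push_cast
  have : (m.factorial : ℝ) ≠ 0 := by positivity
  field_simp
  ring

lemma poiCdf_succ (b : ℕ) (μ : ℝ) : poiCdf (b + 1) μ = poiCdf b μ + poiPmf b μ :=
  Finset.sum_range_succ _ _

lemma poiShortfall_succ (a : ℕ) (μ : ℝ) :
    poiShortfall (a + 1) μ = poiShortfall a μ + poiCdf (a + 1) μ :=
  Finset.sum_range_succ _ _

lemma hasDerivAt_poiPmf_zero (μ : ℝ) : HasDerivAt (poiPmf 0) (-poiPmf 0 μ) μ := by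
  have h : poiPmf 0 = fun x => Real.exp (-x) := by
    funext x; simp [poiPmf]
  rw [h]
  simpa using (hasDerivAt_neg μ).exp

lemma hasDerivAt_poiPmf_succ (m : ℕ) (μ : ℝ) :
    HasDerivAt (poiPmf (m + 1)) (poiPmf m μ - poiPmf (m + 1) μ) μ := by
  have h := (((hasDerivAt_neg μ).exp).mul (hasDerivAt_pow (m + 1) μ)).div_const
    ((m + 1).factorial : ℝ)
  refine h.congr_deriv ?_
  unfold poiPmf
  rw [Nat.factorial_succ]
  push_cast
  have : (m.factorial : ℝ) ≠ 0 := by positivity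
  field_simp
  ring

lemma hasDerivAt_poiCdf_succ (b : ℕ) (μ : ℝ) :
    HasDerivAt (poiCdf (b + 1)) (-poiPmf b μ) μ := by
  induction b with
  | zero =>
    have h : poiCdf (0 + 1) = poiPmf 0 := by funext x; simp [poiCdf]
    rw [h]
    exact hasDerivAt_poiPmf_zero μ
  | succ b ih =>
    have h : poiCdf (b + 1 + 1) = poiCdf (b + 1) + poiPmf (b + 1) := by
      funext x; exact poiCdf_succ _ _
    rw [h]
    refine (ih.add (hasDerivAt_poiPmf_succ b μ)).congr_deriv ?_
    ring

lemma hasDerivAt_poiShortfall (a : ℕ) (μ : ℝ) :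
    HasDerivAt (poiShortfall a) (-poiCdf a μ) μ := by
  have h := HasDerivAt.fun_sum (u := Finset.range a)
    fun b _ => hasDerivAt_poiCdf_succ b μ
  exact h.congr_deriv (by simp [poiCdf])

lemma antitoneOn_poiCdf (b : ℕ) : AntitoneOn (poiCdf b) (Set.Ici 0) := by
  cases b with
  | zero =>
    intro x _ y _ _
    simp [poiCdf]
  | succ b =>
    refine antitoneOn_of_deriv_nonpos (convex_Ici 0)
      (fun x _ => (hasDerivAt_poiCdf_succ b x).continuousAt.continuousWithinAt)
      (fun x _ => (hasDerivAt_poiCdf_succ b x).differentiableAt.differentiableWithinAt) ?_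
    intro x hx
    rw [interior_Ici] at hx
    rw [(hasDerivAt_poiCdf_succ b x).deriv]
    linarith [poiPmf_nonneg b (le_of_lt hx)]

lemma antitoneOn_poiShortfall (a : ℕ) : AntitoneOn (poiShortfall a) (Set.Ici 0) := by
  intro x hx y hy hxy
  exact Finset.sum_le_sum fun b _ => antitoneOn_poiCdf (b + 1) hx hy hxy

lemma convexOn_poiShortfall (a : ℕ) : ConvexOn ℝ (Set.Ici 0) (poiShortfall a) := by
  refine MonotoneOn.convexOn_of_deriv (convex_Ici 0)
    (fun x _ => (hasDerivAt_poiShortfall a x).continuousAt.continuousWithinAt)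
    (fun x _ => (hasDerivAt_poiShortfall a x).differentiableAt.differentiableWithinAt) ?_
  rw [interior_Ici]
  intro x hx y hy hxy
  rw [(hasDerivAt_poiShortfall a x).deriv, (hasDerivAt_poiShortfall a y).deriv]
  exact neg_le_neg (antitoneOn_poiCdf a (Set.Ioi_subset_Ici_self hx) (Set.Ioi_subset_Ici_self hy) hxy)

/-- The shortfall lies above its tangents. -/
lemma poiShortfall_tangent (a : ℕ) {μ q : ℝ} (hμ : 0 ≤ μ) (hq : 0 ≤ q) :
    poiShortfall a μ - q * poiCdf a μ ≤ poiShortfall a (μ + q) := by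
  have hd : ∀ x, HasDerivAt (fun x => poiShortfall a (μ + x) + x * poiCdf a μ)
      (-poiCdf a (μ + x) + 1 * poiCdf a μ) x := by
    intro x
    have h1 : HasDerivAt (fun x => μ + x) 1 x := (hasDerivAt_id x).const_add μ
    have h2 := (hasDerivAt_poiShortfall a (μ + x)).comp x h1
    rw [mul_one] at h2
    exact h2.add ((hasDerivAt_id x).mul_const _)
  have hm : MonotoneOn (fun x => poiShortfall a (μ + x) + x * poiCdf a μ) (Set.Ici 0) := by
    refine monotoneOn_of_deriv_nonneg (convex_Ici 0)
      (fun x _ => (hd x).continuousAt.continuousWithinAt)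
      (fun x _ => (hd x).differentiableAt.differentiableWithinAt) ?_
    intro x hx
    rw [interior_Ici, Set.mem_Ioi] at hx
    rw [(hd x).deriv]
    have := antitoneOn_poiCdf a (Set.mem_Ici.2 hμ) (Set.mem_Ici.2 (by linarith : 0 ≤ μ + x))
      (by linarith)
    linarith
  have := hm (Set.mem_Ici.2 le_rfl) (Set.mem_Ici.2 hq) hq
  simp only [add_zero, zero_mul] at this
  linarith

lemma poiShortfall_zero_right (a : ℕ) : poiShortfall a 0 = a := by
  have h : ∀ b, poiCdf (b + 1) 0 = 1 := by
    intro b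
    unfold poiCdf
    rw [Finset.sum_range_succ']
    simp [poiPmf]
  simp [poiShortfall, h]

lemma poiShortfall_secant (a : ℕ) {μ M : ℝ} (hμ : 0 ≤ μ) (hM : 0 < M) (h : μ ≤ M) :
    poiShortfall a μ ≤ (1 - μ / M) * a + μ / M * poiShortfall a M := by
  have h1 : μ / M ≤ 1 := (div_le_one hM).2 h
  have h0 : 0 ≤ μ / M := by positivity
  have := (convexOn_poiShortfall a).2 (Set.mem_Ici.2 le_rfl) (Set.mem_Ici.2 hM.le)
    (sub_nonneg.2 h1) h0 (by ring)
  simp only [smul_eq_mul, mul_zero, zero_add, poiShortfall_zero_right] at this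
  rwa [div_mul_cancel₀ _ hM.ne'] at this

/-- Induction on `a` through the recurrence `(m + 1) P(m + 1) = μ P(m)`. At `μ = a` the first term
vanishes, leaving a single point probability that Stirling's formula controls. -/
lemma poiShortfall_eq (a : ℕ) (μ : ℝ) :
    poiShortfall a μ = (a - μ) * poiCdf a μ + a * poiPmf a μ := by
  induction a with
  | zero => simp [poiShortfall, poiCdf]
  | succ a ih =>
    rw [poiShortfall_succ, ih]
    have h := succ_mul_poiPmf_succ a μ
    push_cast
    rw [h, poiCdf_succ]
    ring

lemma poiCdf_le_one (b : ℕ) {μ : ℝ} (hμ : 0 ≤ μ) : poiCdf b μ ≤ 1 := by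
  have h := Real.sum_le_exp_of_nonneg hμ b
  have : poiCdf b μ = Real.exp (-μ) * ∑ i ∈ Finset.range b, μ ^ i / i.factorial := by
    unfold poiCdf poiPmf
    rw [Finset.mul_sum]
    exact Finset.sum_congr rfl fun _ _ => by ring
  rw [this]
  calc _ ≤ Real.exp (-μ) * Real.exp μ := by gcongr
    _ = 1 := by rw [← Real.exp_add]; simp

/-- The recurrence turns the left side into the part of the Poisson mean carried by the values `1,
…, k`, each at most `k`. -/
lemma mul_poiCdf_le (k : ℕ) {μ : ℝ} (hμ : 0 ≤ μ) : μ * poiCdf k μ ≤ k := by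
  calc μ * poiCdf k μ = ∑ m ∈ Finset.range k, ((m : ℝ) + 1) * poiPmf (m + 1) μ := by
        unfold poiCdf
        rw [Finset.mul_sum]
        exact Finset.sum_congr rfl fun m _ => (succ_mul_poiPmf_succ m μ).symm
    _ ≤ ∑ m ∈ Finset.range k, (k : ℝ) * poiPmf (m + 1) μ := by
        refine Finset.sum_le_sum fun m hm => ?_
        have hm' : m + 1 ≤ k := Finset.mem_range.1 hm
        have : (m : ℝ) + 1 ≤ k := by exact_mod_cast hm'
        exact mul_le_mul_of_nonneg_right this (poiPmf_nonneg _ hμ)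
    _ = k * ∑ m ∈ Finset.range k, poiPmf (m + 1) μ := by rw [Finset.mul_sum]
    _ ≤ k * poiCdf (k + 1) μ := by
        gcongr
        unfold poiCdf
        rw [Finset.sum_range_succ']
        linarith [poiPmf_nonneg 0 hμ]
    _ ≤ k * 1 := by gcongr; exact poiCdf_le_one _ hμ
    _ = k := mul_one _

/-! ### Lower bounds on the sold fraction -/

/-- The fraction of `k` units that are sold to a Poisson number, with mean `Λ * k`, of buyers. -/
noncomputable def soldFraction (k : ℕ) (Λ : ℝ) : ℝ := 1 - poiShortfall k (Λ * k) / k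

/-- The shortfall is at most `k` times the probability of falling short, which `mul_poiCdf_le`
bounds by `1 / Λ`. This is strong for large `Λ`, whatever `k` is. -/
lemma one_sub_inv_le_soldFraction {k : ℕ} (hk : 1 ≤ k) {Λ : ℝ} (hΛ : 0 < Λ) :
    1 - 1 / Λ ≤ soldFraction k Λ := by
  have hk0 : (0 : ℝ) < k := by exact_mod_cast hk
  have hμ : 0 ≤ Λ * k := by positivity
  have h1 : poiShortfall k (Λ * k) ≤ k * poiCdf k (Λ * k) := by
    unfold poiShortfall
    calc _ ≤ ∑ b ∈ Finset.range k, poiCdf k (Λ * k) := by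
          refine Finset.sum_le_sum fun b hb => ?_
          refine Finset.sum_le_sum_of_subset_of_nonneg ?_ fun m _ _ => poiPmf_nonneg m hμ
          exact Finset.range_subset_range.2 (Finset.mem_range.1 hb)
      _ = _ := by simp
  have h2 := mul_poiCdf_le k hμ
  have h3 : poiCdf k (Λ * k) ≤ 1 / Λ := by
    rw [le_div_iff₀ hΛ]
    nlinarith
  unfold soldFraction
  have : poiShortfall k (Λ * k) / k ≤ poiCdf k (Λ * k) := by
    rw [div_le_iff₀ hk0]; linarith
  linarith

/-- More demand only lowers the shortfall, so `Λ = 1` is the worst case. There the unsold fraction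
is `exp (-k) * k ^ k / k!`. -/
lemma stirling_le_soldFraction {k : ℕ} (hk : 1 ≤ k) {Λ : ℝ} (hΛ : 1 ≤ Λ) :
    1 - 1 / Real.sqrt (2 * Real.pi * (k : ℝ)) ≤ soldFraction k Λ := by
  have hk0 : (0 : ℝ) < k := by exact_mod_cast hk
  have h1 : poiShortfall k (Λ * k) ≤ poiShortfall k k :=
    antitoneOn_poiShortfall k (Set.mem_Ici.2 hk0.le) (Set.mem_Ici.2 (by positivity))
      (by nlinarith)
  rw [poiShortfall_eq k (k : ℝ), sub_self, zero_mul, zero_add] at h1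
  have h2 : poiPmf k k ≤ 1 / Real.sqrt (2 * Real.pi * (k : ℝ)) := by
    have h := Stirling.le_factorial_stirling k
    have hs : 0 < Real.sqrt (2 * Real.pi * (k : ℝ)) := by positivity
    unfold poiPmf
    rw [div_le_div_iff₀ (by positivity) hs]
    have : Real.exp (-(k : ℝ)) * (k : ℝ) ^ k = ((k : ℝ) / Real.exp 1) ^ k := by
      rw [div_pow, ← Real.exp_nat_mul, mul_one, Real.exp_neg]
      ring
    rw [this]
    linarith
  unfold soldFraction
  have : poiShortfall k (Λ * k) / k ≤ poiPmf k k := by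
    rw [div_le_iff₀ hk0]; linarith
  linarith

lemma half_le_stirling {k : ℕ} (hk : 1 ≤ k) :
    1 / 2 ≤ 1 - 1 / Real.sqrt (2 * Real.pi * (k : ℝ)) := by
  have hk0 : (1 : ℝ) ≤ k := by exact_mod_cast hk
  have : 2 ≤ Real.sqrt (2 * Real.pi * (k : ℝ)) := by
    apply Real.le_sqrt_of_sq_le
    nlinarith [Real.pi_gt_three]
  have : 1 / Real.sqrt (2 * Real.pi * (k : ℝ)) ≤ 1 / 2 := by gcongr
  linarith

lemma inv_soldFraction_le {k : ℕ} (hk : 1 ≤ k) {Λ : ℝ} (hΛ : 1 ≤ Λ) :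
    (soldFraction k Λ)⁻¹ ≤ 1 + 2 / Λ := by
  have h0 : 0 < Λ := by linarith
  have h1 := one_sub_inv_le_soldFraction hk h0
  have h2 := (half_le_stirling hk).trans (stirling_le_soldFraction hk hΛ)
  have hs : 0 < soldFraction k Λ := by linarith
  rw [inv_le_iff_one_le_mul₀ hs]
  have e : 1 + 2 / Λ = (Λ + 2) * (1 / Λ) := by field_simp
  set y := 1 / Λ with hy
  have hyp : 0 < y := by positivity
  have hy1 : Λ * y = 1 := by rw [hy]; field_simp
  rw [e]
  have : (Λ + 2) * y = 1 + 2 * y := by linear_combination hy1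
  rw [this]
  -- For `y ≤ 1/2` the bound `1 - y` suffices, since `(1 - y)(1 + 2y) ≥ 1`; for `y ≥ 1/2` the bound
  -- `1/2` does.
  rcases le_total y (1 / 2) with h | h
  · nlinarith
  · nlinarith

/-! ### Poisson comparison for Bernoulli sums -/

/-- The expected shortfall of a sum of independent Bernoulli variables is at most that of the
Poisson variable with the same mean. -/
lemma integral_shortfall_le {Ω ι : Type*} [MeasurableSpace Ω] {P : Measure Ω}
    [IsProbabilityMeasure P] [DecidableEq ι] {X : ι → Ω → ℕ}
    (hX : ProbabilityTheory.iIndepFun X P) (hm : ∀ i, Measurable (X i)) (h1 : ∀ i ω, X i ω ≤ 1)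
    (L : Finset ι) (a : ℕ) :
    ∫ ω, ((a - ∑ i ∈ L, X i ω : ℕ) : ℝ) ∂P ≤ poiShortfall a (∑ i ∈ L, ∫ ω, (X i ω : ℝ) ∂P) := by
  induction L using Finset.induction_on generalizing a with
  | empty => simp [poiShortfall_zero_right]
  | insert i L hi ih =>
    cases a with
    | zero => simp [poiShortfall]
    | succ a =>
      set N : Ω → ℕ := fun ω => ∑ j ∈ L, X j ω with hN
      have hNm : Measurable N := Finset.measurable_fun_sum _ fun j _ => hm j
      have hind : ProbabilityTheory.IndepFun N (X i) P := by
        have := hX.indepFun_finsetSum_of_notMem hm hi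
        convert this using 1
        funext ω
        simp [hN]
      have hb : ∀ (b : ℕ) (f : Ω → ℕ), Measurable f → (∀ ω, f ω ≤ b) →
          Integrable (fun ω => (f ω : ℝ)) P := by
        intro b f hf hfb
        refine Integrable.of_bound (measurable_from_nat.comp hf).aestronglyMeasurable (b : ℝ)
          (ae_of_all _ fun ω => ?_)
        simpa using hfb ω
      have hsub : ∀ b : ℕ, Measurable fun ω => b - N ω := fun b =>
        (measurable_from_nat (f := fun m : ℕ => b - m)).comp hNm
      set s : ℝ := ∫ ω, (X i ω : ℝ) ∂P with hs
      have hs0 : 0 ≤ s := integral_nonneg fun ω => Nat.cast_nonneg _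
      have hs1 : s ≤ 1 := by
        calc s ≤ ∫ ω, (1 : ℝ) ∂P :=
              integral_mono (hb 1 _ (hm i) (h1 i)) (integrable_const _) fun ω => by
                simpa using (Nat.cast_le (α := ℝ)).2 (h1 i ω)
          _ = 1 := by simp
      set μ : ℝ := ∑ j ∈ L, ∫ ω, (X j ω : ℝ) ∂P with hμ
      have hμ0 : 0 ≤ μ := Finset.sum_nonneg fun j _ => integral_nonneg fun ω => Nat.cast_nonneg _
      have hprod : ∀ b : ℕ, ∫ ω, ((b - N ω : ℕ) : ℝ) * (X i ω : ℝ) ∂P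
          = (∫ ω, ((b - N ω : ℕ) : ℝ) ∂P) * s := by
        intro b
        have h : ProbabilityTheory.IndepFun (fun ω => ((b - N ω : ℕ) : ℝ))
            (fun ω => (X i ω : ℝ)) P := hind.comp (φ := fun m : ℕ => ((b - m : ℕ) : ℝ)) (ψ := fun m : ℕ => (m : ℝ))
          measurable_from_nat measurable_from_nat
        exact h.integral_fun_mul_eq_mul_integral
          (measurable_from_nat.comp (hsub b)).aestronglyMeasurable
          (measurable_from_nat.comp (hm i)).aestronglyMeasurable
      have hpi : ∀ b : ℕ, Integrable (fun ω => ((b - N ω : ℕ) : ℝ) * (X i ω : ℝ)) P := by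
        intro b
        have := hb b (fun ω => (b - N ω) * X i ω) ((hsub b).mul (hm i)) fun ω =>
          (Nat.mul_le_mul (Nat.sub_le _ _) (h1 i ω)).trans (by simp)
        simpa using this
      have hpt : ∀ ω, ((a + 1 - ∑ j ∈ insert i L, X j ω : ℕ) : ℝ)
          = ((a + 1 - N ω : ℕ) : ℝ) - ((a + 1 - N ω : ℕ) : ℝ) * (X i ω : ℝ)
            + ((a - N ω : ℕ) : ℝ) * (X i ω : ℝ) := by
        intro ω
        rw [Finset.sum_insert hi]
        have := h1 i ω
        have hX01 : X i ω = 0 ∨ X i ω = 1 := by omega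
        rcases hX01 with h | h
        · simp [h, hN]
        · rw [h]
          have : a + 1 - (1 + ∑ j ∈ L, X j ω) = a - N ω := by
            simp only [hN]; omega
          rw [this]
          push_cast
          ring
      have hi1 := hb (a + 1) _ (hsub (a + 1)) fun ω => Nat.sub_le _ _
      -- Condition on `X i`: a success lowers the level from `a + 1` to `a`. By induction the result
      -- is at most the tangent of the Poisson shortfall at `μ`, evaluated at `μ + s`.
      calc ∫ ω, ((a + 1 - ∑ j ∈ insert i L, X j ω : ℕ) : ℝ) ∂P
          = (∫ ω, ((a + 1 - N ω : ℕ) : ℝ) ∂P) - (∫ ω, ((a + 1 - N ω : ℕ) : ℝ) ∂P) * s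
            + (∫ ω, ((a - N ω : ℕ) : ℝ) ∂P) * s := by
            rw [← hprod, ← hprod, ← integral_sub hi1 (hpi _), ← integral_add _ (hpi _)]
            · exact integral_congr_ae (ae_of_all _ hpt)
            · exact hi1.sub (hpi _)
        _ = (1 - s) * (∫ ω, ((a + 1 - N ω : ℕ) : ℝ) ∂P)
            + s * (∫ ω, ((a - N ω : ℕ) : ℝ) ∂P) := by ring
        _ ≤ (1 - s) * poiShortfall (a + 1) μ + s * poiShortfall a μ :=
            add_le_add (mul_le_mul_of_nonneg_left (ih (a + 1)) (by linarith))
              (mul_le_mul_of_nonneg_left (ih a) hs0)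
        _ = poiShortfall (a + 1) μ - s * poiCdf (a + 1) μ := by
            rw [poiShortfall_succ]; ring
        _ ≤ poiShortfall (a + 1) (μ + s) := poiShortfall_tangent _ hμ0 hs0
        _ = _ := by rw [Finset.sum_insert hi, add_comm μ s]

/-! ### Greedy selection and the layer-cake comparison -/

/-- The greedy choice of at most `k` elements is optimal on every superlevel set of the weights. -/
lemma exists_greedy {ι : Type*} [DecidableEq ι] (w : ι → ℝ) (k : ℕ) (R : Finset ι) :
    ∃ S ⊆ R, S.card ≤ k ∧ ∀ t : ℝ,
      min k (R.filter fun i => t < w i).card ≤ (S.filter fun i => t < w i).card := by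
  induction k generalizing R with
  | zero => exact ⟨∅, by simp, by simp, by simp⟩
  | succ k ih =>
    rcases R.eq_empty_or_nonempty with rfl | hR
    · exact ⟨∅, by simp, by simp, by simp⟩
    obtain ⟨i, hiR, hi⟩ := R.exists_max_image w hR
    obtain ⟨S, hSR, hSk, hS⟩ := ih (R.erase i)
    have hiS : i ∉ S := fun h => by simpa using hSR h
    refine ⟨insert i S, ?_, ?_, fun t => ?_⟩
    · exact Finset.insert_subset hiR (hSR.trans (Finset.erase_subset _ _))
    · rw [Finset.card_insert_of_notMem hiS]; omega
    · rcases lt_or_ge t (w i) with ht | ht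
      · have h1 : (R.filter fun j => t < w j).card
            = ((R.erase i).filter fun j => t < w j).card + 1 := by
          rw [← Finset.insert_erase hiR, Finset.filter_insert, if_pos ht,
            Finset.card_insert_of_notMem (by simp), Finset.erase_insert (by simp)]
        rw [h1, Finset.filter_insert, if_pos ht, Finset.card_insert_of_notMem (by simp [hiS])]
        have := hS t
        omega
      · have : (R.filter fun j => t < w j) = ∅ := by
          refine Finset.filter_eq_empty_iff.2 fun j hj => ?_
          exact not_lt.2 ((hi j hj).trans ht)
        simp [this]

/-- Layer cake: `w i` is the length of `[0, w i)`, so both sides are integrals over `t ≥ 0` of the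
superlevel sums being compared. -/
lemma sum_mul_le_of_superlevel {ι : Type*} [Fintype ι] {w a b : ι → ℝ} (hw : ∀ i, 0 ≤ w i)
    (h : ∀ t : ℝ, ∑ i with t < w i, b i ≤ ∑ i with t < w i, a i) :
    ∑ i, b i * w i ≤ ∑ i, a i * w i := by
  have key : ∀ c : ι → ℝ, ∑ i, c i * w i
      = ∫ t, ∑ i, c i * (Set.Ico 0 (w i)).indicator (fun _ => (1 : ℝ)) t := by
    intro c
    rw [integral_finsetSum]
    · refine Finset.sum_congr rfl fun i _ => ?_
      rw [integral_const_mul, integral_indicator_const _ measurableSet_Ico]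
      simp [hw i]
    · intro i _
      refine Integrable.const_mul ?_ _
      exact (integrable_indicator_iff measurableSet_Ico).2 (by simp)
  have hint : ∀ c : ι → ℝ, Integrable
      (fun t => ∑ i, c i * (Set.Ico 0 (w i)).indicator (fun _ => (1 : ℝ)) t) := by
    intro c
    refine integrable_finsetSum _ fun i _ => Integrable.const_mul ?_ _
    exact (integrable_indicator_iff measurableSet_Ico).2 (by simp)
  rw [key, key]
  refine integral_mono (hint _) (hint _) fun t => ?_
  rcases lt_or_ge t 0 with ht | ht
  · have : ∀ i, t ∉ Set.Ico 0 (w i) := fun i hi => absurd hi.1 (not_le.2 ht)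
    simp [this]
  · have : ∀ c : ι → ℝ, ∑ i, c i * (Set.Ico 0 (w i)).indicator (fun _ => (1 : ℝ)) t
        = ∑ i with t < w i, c i := by
      intro c
      rw [Finset.sum_filter]
      refine Finset.sum_congr rfl fun i _ => ?_
      by_cases hti : t < w i
      · simp [hti, ht]
      · simp [hti]
    simpa only [this] using h t

/-! ### Posted-price mechanisms -/

instance {n : ℕ} (F : Fin n → ProbabilityMeasure ℝ≥0) : IsProbabilityMeasure (law F) := by
  unfold law; infer_instance

/-- The agents whose values exceed the prices posted to them. -/
noncomputable def buyers {n : ℕ} (p v : Values n) : Finset (Fin n) := Finset.univ.filter fun i => p i < v i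

lemma mem_buyers {n : ℕ} {p v : Values n} {i : Fin n} : i ∈ buyers p v ↔ p i < v i := by
  simp [buyers]

lemma buyers_update {n : ℕ} (p v : Values n) (i : Fin n) (r : ℝ≥0) :
    buyers p (Function.update v i r)
      = if p i < r then insert i (buyers p v) else (buyers p v).erase i := by
  ext j
  by_cases hj : j = i
  · subst hj
    split_ifs with h <;> simp [mem_buyers, h]
  · split_ifs with h <;> simp [mem_buyers, hj]

lemma measurable_comp_buyers {n : ℕ} {β : Type*} [MeasurableSpace β] (p : Values n)
    (φ : Finset (Fin n) → β) : Measurable fun v => φ (buyers p v) := by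
  have h1 : Measurable fun (v : Values n) (i : Fin n) => decide (p i < v i) := by
    refine measurable_pi_lambda _ fun i => ?_
    have : Measurable fun x : ℝ≥0 => decide (p i < x) := by
      refine measurable_to_bool ?_
      have : (fun x : ℝ≥0 => decide (p i < x)) ⁻¹' {true} = Set.Ioi (p i) := by
        ext x; simp
      rw [this]
      exact measurableSet_Ioi
    exact this.comp (measurable_pi_apply i)
  have h2 : Measurable fun b : Fin n → Bool => φ (Finset.univ.filter fun i => b i = true) :=
    Measurable.of_discrete
  have := h2.comp h1
  convert this using 2 with v
  simp [buyers]

lemma postedPrice_utility {n : ℕ} (A : Finset (Fin n)) (i : Fin n) (t q : ℝ≥0) :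
    (t : ℝ) * (∑ S with i ∈ S, ((if S = A then 1 else 0 : ℝ≥0) : ℝ))
      - ((if i ∈ A then q else 0 : ℝ≥0) : ℝ) = if i ∈ A then (t : ℝ) - q else 0 := by
  rw [Finset.sum_filter]
  have : ∀ S, (if i ∈ S then ((if S = A then 1 else 0 : ℝ≥0) : ℝ) else 0)
      = if S = A then (if i ∈ A then 1 else 0 : ℝ) else 0 := by
    intro S
    by_cases h : S = A
    · subst h; simp
    · simp [h]
  simp only [this]
  rw [Finset.sum_ite_eq']
  split_ifs <;> simp_all

/-- The mechanism that offers agent `i` a unit at the price `p i` and serves the subset `g R` of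
the set `R` of agents that accept. -/
noncomputable def postedPrice {n k : ℕ} (F : Fin n → ProbabilityMeasure ℝ≥0) (p : Values n)
    (g : Finset (Fin n) → Finset (Fin n)) (hsub : ∀ R, g R ⊆ R) (hcard : ∀ R, (g R).card ≤ k) :
    Mechanism F (identicalGoods n k) where
  outcome v S := if S = g (buyers p v) then 1 else 0
  pay v i := if i ∈ g (buyers p v) then p i else 0
  measurable_outcome S := measurable_comp_buyers p fun R => if S = g R then 1 else 0
  measurable_pay i := measurable_comp_buyers p fun R => if i ∈ g R then p i else 0
  outcome_feasible v S hS := by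
    refine if_neg ?_
    rintro rfl
    exact hS (by simp [identicalGoods, hcard])
  outcome_sum v := by simp
  integrable_pay i := by
    have h := measurable_comp_buyers p fun R => (((if i ∈ g R then p i else 0 : ℝ≥0)) : ℝ)
    refine Integrable.of_bound h.aestronglyMeasurable (p i) (ae_of_all _ fun v => ?_)
    split_ifs <;> simp
  integrable_interim i r := by
    have h := (measurable_comp_buyers p fun R => (((if i ∈ g R then p i else 0 : ℝ≥0)) : ℝ)).comp
      (measurable_update_left (a := i) (x := r) (X := fun _ : Fin n => ℝ≥0))
    refine Integrable.of_bound h.aestronglyMeasurable (p i) (ae_of_all _ fun v => ?_)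
    split_ifs <;> simp
  incentiveCompatible i t r := by
    simp only [postedPrice_utility]
    have hint : ∀ r : ℝ≥0, Integrable (fun v => if i ∈ g (buyers p (Function.update v i r))
        then (t : ℝ) - p i else 0) (law F) := by
      intro r
      have h := (measurable_comp_buyers p fun R => (if i ∈ g R then (t : ℝ) - p i else 0)).comp
        (measurable_update_left (a := i) (x := r) (X := fun _ : Fin n => ℝ≥0))
      refine Integrable.of_bound h.aestronglyMeasurable |(t : ℝ) - p i| (ae_of_all _ fun v => ?_)
      split_ifs <;> simp
    -- Truthfulness holds profile by profile: a report affects the outcome only through whether it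
    -- exceeds the price.
    refine integral_mono (hint r) (hint t) fun v => ?_
    have hmem : ∀ r : ℝ≥0, i ∈ g (buyers p (Function.update v i r)) → p i < r := by
      intro r h
      simpa using mem_buyers.1 (hsub _ h)
    rcases lt_or_ge (p i) t with ht | ht
    · have ht' : (0 : ℝ) ≤ t - p i := sub_nonneg.2 (by exact_mod_cast ht.le)
      by_cases hr : p i < r
      · simp [buyers_update, hr, ht]
      · have : i ∉ g (buyers p (Function.update v i r)) := fun h => hr (hmem r h)
        simp only [this, if_false]
        split_ifs <;> simp [ht']
    · have ht' : (t : ℝ) - p i ≤ 0 := sub_nonpos.2 (by exact_mod_cast ht)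
      have : i ∉ g (buyers p (Function.update v i t)) := fun h => (hmem t h).not_ge ht
      simp only [this, if_false]
      split_ifs <;> simp [ht']
  individuallyRational i t := by
    simp only [postedPrice_utility]
    refine integral_nonneg fun v => ?_
    by_cases h : i ∈ g (buyers p (Function.update v i t))
    · have : p i < t := by simpa using mem_buyers.1 (hsub _ h)
      have : (p i : ℝ) ≤ t := by exact_mod_cast this.le
      simp [h, this]
    · simp [h]

lemma consumerSurplus_postedPrice {n k : ℕ} (F : Fin n → ProbabilityMeasure ℝ≥0) (p : Values n)
    (g : Finset (Fin n) → Finset (Fin n)) (hsub : ∀ R, g R ⊆ R) (hcard : ∀ R, (g R).card ≤ k) :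
    (postedPrice F p g hsub hcard).consumerSurplus
      = ∫ v, ∑ i, (if i ∈ g (buyers p v) then ((v i : ℝ) - p i) else 0) ∂(law F) := by
  unfold Mechanism.consumerSurplus postedPrice
  refine integral_congr_ae (ae_of_all _ fun v => ?_)
  simp only
  have : ∀ S, ((if S = g (buyers p v) then 1 else 0 : ℝ≥0) : ℝ) * (∑ i ∈ S, (v i : ℝ))
      = if S = g (buyers p v) then ∑ i ∈ S, (v i : ℝ) else 0 := by
    intro S
    split_ifs <;> simp
  simp only [this]
  rw [Finset.sum_ite_eq', if_pos (Finset.mem_univ _), 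
    ← Finset.univ_inter (g (buyers p v)), ← Finset.sum_ite_mem, Finset.univ_inter,
    ← Finset.sum_sub_distrib]
  refine Finset.sum_congr rfl fun i _ => ?_
  split_ifs <;> simp

/-! ### Consumer surplus of the greedy posted-price mechanism -/

lemma indepFun_value_others {n : ℕ} (F : Fin n → ProbabilityMeasure ℝ≥0) (i : Fin n) :
    ProbabilityTheory.IndepFun (fun (v : Values n) (j : ({i} : Finset (Fin n))) => v j)
      (fun (v : Values n) (j : Finset.univ.erase i) => v j) (law F) := by
  have h : ProbabilityTheory.iIndepFun (fun (j : Fin n) (v : Values n) => v j) (law F) :=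
    ProbabilityTheory.iIndepFun_pi (X := fun _ x => x) fun j => aemeasurable_id
  exact h.indepFun_finset {i} (Finset.univ.erase i) (by simp) fun j => measurable_pi_apply j

lemma integral_comp_value {n : ℕ} (F : Fin n → ProbabilityMeasure ℝ≥0) (i : Fin n) {φ : ℝ≥0 → ℝ}
    (hφ : Measurable φ) : ∫ v, φ (v i) ∂(law F) = ∫ x, φ x ∂(F i : Measure ℝ≥0) :=
  integral_comp_eval (μ := fun i => (F i : Measure ℝ≥0)) hφ.aestronglyMeasurable

lemma integral_value_mul_others {n : ℕ} (F : Fin n → ProbabilityMeasure ℝ≥0) (p : Values n)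
    (i : Fin n) {φ : ℝ≥0 → ℝ} (hφ : Measurable φ) (H : Finset (Fin n) → ℝ) :
    ∫ v, φ (v i) * H ((buyers p v).erase i) ∂(law F)
      = (∫ x, φ x ∂(F i : Measure ℝ≥0)) * ∫ v, H ((buyers p v).erase i) ∂(law F) := by
  rw [← integral_comp_value F i hφ]
  -- The missing coordinate is filled with `0`, which never exceeds a price; so `i` is not a buyer
  -- in the extended profile.
  set ψ : (Finset.univ.erase i → ℝ≥0) → Values n :=
    fun u j => if h : j ∈ Finset.univ.erase i then u ⟨j, h⟩ else 0 with hψ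
  have hψm : Measurable ψ := by
    refine measurable_pi_lambda _ fun j => ?_
    by_cases h : j ∈ Finset.univ.erase i
    · simp only [hψ, h, dif_pos]
      exact measurable_pi_apply _
    · simp only [hψ, h, dif_neg, not_false_eq_true]
      exact measurable_const
  have hψe : ∀ v : Values n, buyers p (ψ fun j => v j) = (buyers p v).erase i := by
    intro v
    ext j
    by_cases h : j = i
    · subst h; simp [mem_buyers, hψ]
    · simp [mem_buyers, hψ, h]
  have hφi : Measurable fun u : ({i} : Finset (Fin n)) → ℝ≥0 => φ (u ⟨i, by simp⟩) :=
    hφ.comp (measurable_pi_apply _)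
  have h := (indepFun_value_others F i).comp (φ := fun u => φ (u ⟨i, by simp⟩))
    (ψ := fun u => H (buyers p (ψ u))) hφi
    ((measurable_comp_buyers p H).comp hψm)
  simp only [Function.comp_def, hψe] at h
  refine h.integral_fun_mul_eq_mul_integral
    (hφ.comp (measurable_pi_apply i)).aestronglyMeasurable ?_
  exact (measurable_comp_buyers p fun R => H (R.erase i)).aestronglyMeasurable

/-- The expected utility of agent `i` from an unrestricted offer at the price `q`. -/
noncomputable def offerUtility (μ : Measure ℝ≥0) (q : ℝ≥0) : ℝ := ∫ x, ((x - q : ℝ≥0) : ℝ) ∂μ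

lemma integrable_offer {μ : Measure ℝ≥0} (h : Integrable (fun x : ℝ≥0 => (x : ℝ)) μ) (q : ℝ≥0) :
    Integrable (fun x : ℝ≥0 => ((x - q : ℝ≥0) : ℝ)) μ := by
  refine h.mono (by fun_prop) (ae_of_all _ fun x => ?_)
  simp

lemma offerUtility_nonneg (μ : Measure ℝ≥0) (q : ℝ≥0) : 0 ≤ offerUtility μ q :=
  integral_nonneg fun _ => NNReal.coe_nonneg _

lemma offerUtility_eq_zero {μ : Measure ℝ≥0} [IsFiniteMeasure μ] {q : ℝ≥0}
    (h : μ.real (Set.Ioi q) = 0) : offerUtility μ q = 0 := by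
  refine integral_eq_zero_of_ae ?_
  have : μ (Set.Ioi q) = 0 := by simpa [measureReal_def, ENNReal.toReal_eq_zero_iff] using h
  filter_upwards [measure_eq_zero_iff_ae_notMem.1 this] with x hx
  have : x ≤ q := not_lt.1 hx
  simp [tsub_eq_zero_of_le this]

/-- With `s i` the acceptance probability and `e i` the probability of being served given
acceptance, agent `i` contributes `m i * e i = (s i * e i) * w i`. It therefore suffices to bound
the expected number served in each superlevel set of `w`. -/
lemma exists_mechanism {n k : ℕ} (hk : 1 ≤ k) (F : Fin n → ProbabilityMeasure ℝ≥0)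
    (hF : ∀ i, Integrable (fun x : ℝ≥0 => (x : ℝ)) (F i : Measure ℝ≥0)) (p : Values n)
    {Λ : ℝ} (hΛ : 0 < Λ)
    (hp : ∑ i, (F i : Measure ℝ≥0).real (Set.Ioi (p i)) ≤ Λ * k) :
    ∃ M : Mechanism F (identicalGoods n k),
      soldFraction k Λ / Λ * ∑ i, offerUtility (F i) (p i) ≤ M.consumerSurplus := by
  have hk0 : (0 : ℝ) < k := by exact_mod_cast hk
  set s : Fin n → ℝ := fun i => (F i : Measure ℝ≥0).real (Set.Ioi (p i)) with hs
  set m : Fin n → ℝ := fun i => offerUtility (F i) (p i) with hm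
  have hs0 : ∀ i, 0 ≤ s i := fun i => measureReal_nonneg
  have hm0 : ∀ i, 0 ≤ m i := fun i => offerUtility_nonneg _ _
  -- The expected utility given acceptance; it is `0` by convention if acceptance has probability
  -- zero, and then `m i = 0` too.
  set w : Fin n → ℝ := fun i => m i / s i with hw
  choose g hsub hcard hg using exists_greedy w k
  refine ⟨postedPrice F p g hsub hcard, ?_⟩
  rw [consumerSurplus_postedPrice]
  -- the probability that agent `i` is served when she accepts
  set H : Fin n → Finset (Fin n) → ℝ := fun i T => if i ∈ g (insert i T) then 1 else 0 with hH
  set e : Fin n → ℝ := fun i => ∫ v, H i ((buyers p v).erase i) ∂(law F) with he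
  have hmem : ∀ (v : Values n) i, i ∈ g (buyers p v) → p i < v i := fun v i h =>
    mem_buyers.1 (hsub _ h)
  have hutil : ∀ i, ∫ v, (if i ∈ g (buyers p v) then ((v i : ℝ) - p i) else 0) ∂(law F)
      = m i * e i := by
    intro i
    refine Eq.trans ?_ (integral_value_mul_others F p i
      (φ := fun x => ((x - p i : ℝ≥0) : ℝ)) (by fun_prop) (H i))
    refine integral_congr_ae (ae_of_all _ fun v => ?_)
    by_cases h : p i < v i
    · have h' : insert i ((buyers p v).erase i) = buyers p v :=
        Finset.insert_erase (mem_buyers.2 h)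
      simp only [hH, h', NNReal.coe_sub h.le]
      split_ifs <;> simp
    · have h' : i ∉ g (buyers p v) := fun h' => h (hmem v i h')
      simp [h', tsub_eq_zero_of_le (not_lt.1 h)]
  have hserved : ∀ i, ∫ v, (if i ∈ g (buyers p v) then (1 : ℝ) else 0) ∂(law F) = s i * e i := by
    intro i
    have hsi : s i = ∫ x, (Set.Ioi (p i)).indicator (fun _ => (1 : ℝ)) x ∂(F i : Measure ℝ≥0) := by
      rw [integral_indicator_const _ measurableSet_Ioi]
      simp [hs]
    rw [hsi, ← integral_value_mul_others F p i
      (measurable_const.indicator measurableSet_Ioi) (H i)]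
    refine integral_congr_ae (ae_of_all _ fun v => ?_)
    by_cases h : p i < v i
    · have h' : insert i ((buyers p v).erase i) = buyers p v :=
        Finset.insert_erase (mem_buyers.2 h)
      simp [hH, h', h]
    · have h' : i ∉ g (buyers p v) := fun h' => h (hmem v i h')
      simp [h', h]
  have hbi : ∀ i, Integrable (fun v => if i ∈ g (buyers p v) then (1 : ℝ) else 0) (law F) := by
    intro i
    refine Integrable.of_bound (measurable_comp_buyers p fun R =>
      if i ∈ g R then (1 : ℝ) else 0).aestronglyMeasurable 1 (ae_of_all _ fun v => ?_)
    split_ifs <;> simp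
  -- the number of accepting agents in `L`
  have hshort : ∀ L : Finset (Fin n),
      ∫ v, ((k - (buyers p v ∩ L).card : ℕ) : ℝ) ∂(law F) ≤ poiShortfall k (∑ i ∈ L, s i) := by
    intro L
    have hXm : ∀ i, Measurable fun x : ℝ≥0 => if p i < x then 1 else 0 := fun i =>
      Measurable.ite measurableSet_Ioi measurable_const measurable_const
    have hX : ProbabilityTheory.iIndepFun
        (fun (i : Fin n) (v : Values n) => if p i < v i then 1 else 0) (law F) :=
      ProbabilityTheory.iIndepFun_pi (X := fun i x => if p i < x then 1 else 0)
        fun i => (hXm i).aemeasurable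
    have h := integral_shortfall_le hX (fun i => (hXm i).comp (measurable_pi_apply i))
      (fun i v => by split_ifs <;> simp) L k
    have h1 : ∀ v : Values n, ∑ i ∈ L, (if p i < v i then 1 else 0) = (buyers p v ∩ L).card := by
      intro v
      rw [Finset.sum_boole, Nat.cast_id]
      congr 1
      ext i
      simp [mem_buyers, and_comm]
    have h2 : ∀ i, ∫ v, ((if p i < v i then 1 else 0 : ℕ) : ℝ) ∂(law F) = s i := by
      intro i
      have : ∀ x : ℝ≥0, ((if p i < x then 1 else 0 : ℕ) : ℝ)
          = (Set.Ioi (p i)).indicator (fun _ => (1 : ℝ)) x := by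
        intro x
        by_cases hx : p i < x <;> simp [hx]
      simp only [this]
      rw [integral_comp_value F i (measurable_const.indicator measurableSet_Ioi),
        integral_indicator_const _ measurableSet_Ioi]
      simp [hs]
    simpa only [h1, h2] using h
  have hcorr : ∀ t : ℝ, ∑ i with t < w i, soldFraction k Λ / Λ * s i
      ≤ ∑ i with t < w i, s i * e i := by
    intro t
    set L : Finset (Fin n) := Finset.univ.filter fun i => t < w i with hL
    have hLs : ∑ i ∈ L, s i ≤ Λ * k :=
      (Finset.sum_le_sum_of_subset_of_nonneg (Finset.subset_univ _) fun i _ _ => hs0 i).trans hp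
    have hL0 : 0 ≤ ∑ i ∈ L, s i := Finset.sum_nonneg fun i _ => hs0 i
    have h1 : ∑ i ∈ L, s i * e i
        = ∫ v, ∑ i ∈ L, (if i ∈ g (buyers p v) then (1 : ℝ) else 0) ∂(law F) := by
      rw [integral_finsetSum _ fun i _ => hbi i]
      exact Finset.sum_congr rfl fun i _ => (hserved i).symm
    have h2 : (k : ℝ) - ∫ v, ((k - (buyers p v ∩ L).card : ℕ) : ℝ) ∂(law F)
        ≤ ∑ i ∈ L, s i * e i := by
      have hi : Integrable (fun v => ((k - (buyers p v ∩ L).card : ℕ) : ℝ)) (law F) := by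
        refine Integrable.of_bound (measurable_comp_buyers p fun R =>
          ((k - (R ∩ L).card : ℕ) : ℝ)).aestronglyMeasurable k (ae_of_all _ fun v => ?_)
        simp
      have hc : (k : ℝ) = ∫ _v, (k : ℝ) ∂(law F) := by simp
      rw [h1]
      nth_rewrite 1 [hc]
      rw [← integral_sub (integrable_const _) hi]
      refine integral_mono ((integrable_const _).sub hi)
        (integrable_finsetSum _ fun i _ => hbi i) fun v => ?_
      have h := hg (buyers p v) t
      have e1 : (buyers p v).filter (fun i => t < w i) = buyers p v ∩ L := by
        ext i; simp [hL]
      have e2 : ∑ i ∈ L, (if i ∈ g (buyers p v) then (1 : ℝ) else 0)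
          = (((g (buyers p v)).filter fun i => t < w i).card : ℝ) := by
        rw [Finset.sum_boole]
        congr 2
        ext i
        simp [hL, and_comm]
      simp only [e2]
      rw [e1] at h
      have h' : k ≤ ((g (buyers p v)).filter fun i => t < w i).card
          + (k - (buyers p v ∩ L).card) := by omega
      have h'' : (k : ℝ) ≤ (((g (buyers p v)).filter fun i => t < w i).card : ℝ)
          + ((k - (buyers p v ∩ L).card : ℕ) : ℝ) := by exact_mod_cast h'
      linarith
    -- The expected number sold to `L` is concave in the mean demand of `L`, hence at least the
    -- chord from `0` to `Λ * k`, of slope `soldFraction k Λ / Λ`.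
    have h3 := poiShortfall_secant k hL0 (by positivity : 0 < Λ * k) hLs
    have h4 := hshort L
    calc ∑ i ∈ L, soldFraction k Λ / Λ * s i
        = (k : ℝ) - ((1 - (∑ i ∈ L, s i) / (Λ * k)) * k
            + (∑ i ∈ L, s i) / (Λ * k) * poiShortfall k (Λ * k)) := by
          rw [← Finset.mul_sum]
          unfold soldFraction
          field_simp
          ring
      _ ≤ _ := by linarith
  have hfin := sum_mul_le_of_superlevel (w := w) (fun i => div_nonneg (hm0 i) (hs0 i)) hcorr
  have hsw : ∀ i, s i * w i = m i := by
    intro i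
    by_cases h : s i = 0
    · have : m i = 0 := offerUtility_eq_zero h
      simp [h, this]
    · simp only [hw]; field_simp
  calc soldFraction k Λ / Λ * ∑ i, m i
      = ∑ i, soldFraction k Λ / Λ * s i * w i := by
        rw [Finset.mul_sum]
        exact Finset.sum_congr rfl fun i _ => by rw [mul_assoc, hsw]
    _ ≤ ∑ i, s i * e i * w i := hfin
    _ = ∑ i, m i * e i := Finset.sum_congr rfl fun i _ => by rw [← hsw i]; ring
    _ = _ := by
        rw [integral_finsetSum]
        · exact Finset.sum_congr rfl fun i _ => (hutil i).symm
        · intro i _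
          have hv : Integrable (fun v : Values n => ((v i - p i : ℝ≥0) : ℝ)) (law F) :=
            integrable_comp_eval (μ := fun i => (F i : Measure ℝ≥0))
              (integrable_offer (hF i) (p i))
          refine hv.mono ?_ (ae_of_all _ fun v => ?_)
          · refine Measurable.aestronglyMeasurable ?_
            refine Measurable.ite ?_ (by fun_prop) measurable_const
            exact measurableSet_setOfPred.2 (measurable_comp_buyers p fun R => i ∈ g R)
          · by_cases h : i ∈ g (buyers p v)
            · simp [h, NNReal.coe_sub (hmem v i h).le]
            · simp [h]

lemma soldFraction_mul_le {n k : ℕ} (hk : 1 ≤ k) (F : Fin n → ProbabilityMeasure ℝ≥0)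
    (hF : ∀ i, Integrable (fun x : ℝ≥0 => (x : ℝ)) (F i : Measure ℝ≥0)) (p : Values n)
    {Λ : ℝ} (hΛ : 1 ≤ Λ)
    (hp : ∑ i, (F i : Measure ℝ≥0).real (Set.Ioi (p i)) ≤ Λ * k) :
    ∑ i, ∫⁻ x, ((x - p i : ℝ≥0) : ℝ≥0∞) ∂(F i : Measure ℝ≥0)
      ≤ ENNReal.ofReal (Λ * (soldFraction k Λ)⁻¹) * optConsumerSurplus F (identicalGoods n k) := by
  obtain ⟨M, hM⟩ := exists_mechanism hk F hF p (by linarith : 0 < Λ) hp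
  have hκ : 0 < soldFraction k Λ := by
    linarith [half_le_stirling hk, stirling_le_soldFraction hk hΛ]
  have h1 : ENNReal.ofReal M.consumerSurplus ≤ optConsumerSurplus F (identicalGoods n k) :=
    le_iSup (fun M : Mechanism F (identicalGoods n k) => ENNReal.ofReal M.consumerSurplus) M
  have h2 : ∀ i, ∫⁻ x, ((x - p i : ℝ≥0) : ℝ≥0∞) ∂(F i : Measure ℝ≥0)
      = ENNReal.ofReal (offerUtility (F i) (p i)) := by
    intro i
    rw [offerUtility, ofReal_integral_eq_lintegral_ofReal (integrable_offer (hF i) _)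
      (ae_of_all _ fun _ => NNReal.coe_nonneg _)]
    simp
  simp only [h2]
  rw [← ENNReal.ofReal_sum_of_nonneg fun i _ => offerUtility_nonneg _ _]
  refine le_trans ?_ (mul_le_mul_right h1 _)
  rw [← ENNReal.ofReal_mul (by positivity)]
  refine ENNReal.ofReal_le_ofReal ?_
  calc ∑ i, offerUtility (F i) (p i)
      = Λ * (soldFraction k Λ)⁻¹ * (soldFraction k Λ / Λ * ∑ i, offerUtility (F i) (p i)) := by
        field_simp
    _ ≤ _ := by gcongr

/-! ### Tails, quantiles and offers -/

/-- The probability that a value exceeds `t`. -/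
noncomputable def tail (μ : Measure ℝ≥0) (t : ℝ) : ℝ≥0∞ := μ {x | t < (x : ℝ)}

lemma tail_antitone (μ : Measure ℝ≥0) : Antitone (tail μ) := fun _ _ h =>
  measure_mono fun _ hx => lt_of_le_of_lt h hx

lemma tail_le_one (μ : Measure ℝ≥0) [IsProbabilityMeasure μ] (t : ℝ) : tail μ t ≤ 1 :=
  prob_le_one

lemma lintegral_offer_eq (μ : Measure ℝ≥0) (p : ℝ≥0) :
    ∫⁻ x, ((x - p : ℝ≥0) : ℝ≥0∞) ∂μ = ∫⁻ t in Set.Ioi (p : ℝ), tail μ t := by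
  have h := lintegral_eq_lintegral_meas_lt μ (f := fun x : ℝ≥0 => ((x - p : ℝ≥0) : ℝ))
    (ae_of_all _ fun _ => NNReal.coe_nonneg _) (by fun_prop)
  simp only [ENNReal.ofReal_coe_nnreal] at h
  rw [h]
  have h2 : ∫⁻ t in Set.Ioi (p : ℝ), tail μ t
      = ∫⁻ t in (fun t : ℝ => t + p) ⁻¹' Set.Ioi (p : ℝ), tail μ (t + p) :=
    ((measurePreserving_add_right volume (p : ℝ)).setLIntegral_comp_preimage measurableSet_Ioi
      (tail_antitone μ).measurable).symm
  rw [h2]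
  have h3 : (fun t : ℝ => t + p) ⁻¹' Set.Ioi (p : ℝ) = Set.Ioi 0 := by ext; simp
  rw [h3]
  refine setLIntegral_congr_fun measurableSet_Ioi fun t ht => ?_
  unfold tail
  congr 1
  ext x
  have ht' : 0 < t := ht
  simp only [Set.mem_ofPred_eq, NNReal.coe_sub_def, lt_max_iff, ht'.not_gt, or_false]
  exact lt_sub_iff_add_lt

lemma tendsto_measure_Ioi_atTop (μ : Measure ℝ≥0) [IsProbabilityMeasure μ] :
    Tendsto (fun m : ℕ => μ (Set.Ioi (m : ℝ≥0))) atTop (𝓝 0) := by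
  have h := tendsto_measure_iInter_atTop (μ := μ) (s := fun m : ℕ => Set.Ioi (m : ℝ≥0))
    (fun m => measurableSet_Ioi.nullMeasurableSet)
    (fun a b hab => Set.Ioi_subset_Ioi (by exact_mod_cast hab)) ⟨0, measure_ne_top _ _⟩
  have h0 : ⋂ m : ℕ, Set.Ioi (m : ℝ≥0) = ∅ := by
    refine Set.eq_empty_of_forall_notMem fun x hx => ?_
    obtain ⟨m, hm⟩ := exists_nat_gt x
    exact absurd (Set.mem_iInter.1 hx m) (not_lt.2 hm.le)
  rwa [h0, measure_empty] at h

/-- A quantile: the smallest price at which the probability of selling is at most `s`. -/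
lemma exists_quantile (μ : Measure ℝ≥0) [IsProbabilityMeasure μ] {s : ℝ≥0∞} (hs : 0 < s) :
    ∃ p : ℝ≥0, μ (Set.Ioi p) ≤ s ∧ ∀ t : ℝ≥0, μ (Set.Ioi t) ≤ s → p ≤ t := by
  set A : Set ℝ≥0 := {t | μ (Set.Ioi t) ≤ s} with hA
  have hne : A.Nonempty := by
    obtain ⟨m, hm⟩ := ((tendsto_measure_Ioi_atTop μ).eventually (gt_mem_nhds hs)).exists
    exact ⟨m, hm.le⟩
  refine ⟨sInf A, ?_, fun t ht => csInf_le (OrderBot.bddBelow _) ht⟩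
  -- Right-continuity of the tail, so that the infimum is attained.
  have hU : Set.Ioi (sInf A) = ⋃ m : ℕ, Set.Ioi (sInf A + 1 / ((m : ℝ≥0) + 1)) := by
    ext x
    simp only [Set.mem_Ioi, Set.mem_iUnion]
    constructor
    · intro h
      obtain ⟨m, hm⟩ := exists_nat_one_div_lt (tsub_pos_of_lt h)
      exact ⟨m, by rw [add_comm]; exact lt_tsub_iff_right.1 hm⟩
    · rintro ⟨m, hm⟩
      exact lt_of_le_of_lt le_self_add hm
  have hmono : Monotone fun m : ℕ => Set.Ioi (sInf A + 1 / ((m : ℝ≥0) + 1)) := by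
    intro a b hab
    refine Set.Ioi_subset_Ioi ?_
    gcongr
  rw [hU, hmono.measure_iUnion]
  refine iSup_le fun m => ?_
  obtain ⟨t, ht, htl⟩ := exists_lt_of_csInf_lt hne
    (lt_add_of_pos_right (sInf A) (by positivity : 0 < 1 / ((m : ℝ≥0) + 1)))
  exact (measure_mono (Set.Ioi_subset_Ioi htl.le)).trans ht

/-- At the quantile price `p`, every `t > 0` with tail at most `s` satisfies `p ≤ t`, and the
utility of the offer is the integral of the tail beyond `p`. Atoms do no harm: `p` may sell with
probability below `s`. -/
lemma exists_price (μ : Measure ℝ≥0) [IsProbabilityMeasure μ] {s : ℝ≥0∞} (hs : 0 < s) :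
    ∃ p : ℝ≥0, μ (Set.Ioi p) ≤ s ∧
      ∫⁻ t in Set.Ioi (0 : ℝ), (if tail μ t ≤ s then tail μ t else 0)
        ≤ ∫⁻ x, ((x - p : ℝ≥0) : ℝ≥0∞) ∂μ := by
  obtain ⟨p, hp, hmin⟩ := exists_quantile μ hs
  refine ⟨p, hp, ?_⟩
  rw [lintegral_offer_eq, setLIntegral_congr (Ioi_ae_eq_Ici (a := (p : ℝ))), ← lintegral_indicator measurableSet_Ici,
    ← lintegral_indicator measurableSet_Ioi]
  refine lintegral_mono fun t => ?_
  by_cases ht : t ∈ Set.Ioi (0 : ℝ)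
  · rw [Set.indicator_of_mem ht]
    split_ifs with h
    · have : p ≤ ⟨t, le_of_lt ht⟩ := by
        refine hmin _ (le_trans (le_of_eq ?_) h)
        unfold tail
        congr 1
      rw [Set.indicator_of_mem (show t ∈ Set.Ici (p : ℝ) from NNReal.coe_le_coe.2 this)]
    · exact zero_le
  · rw [Set.indicator_of_notMem ht]
    exact zero_le

/-! ### Averaging over scaled quantiles -/

lemma lintegral_inv_sq_Ioi {a : ℝ} (ha : 0 < a) :
    ∫⁻ l in Set.Ioi a, ENNReal.ofReal (l ^ (-2 : ℝ)) = ENNReal.ofReal a⁻¹ := by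
  rw [← ofReal_integral_eq_lintegral_ofReal (integrableOn_Ioi_rpow_of_lt (by norm_num) ha),
    integral_Ioi_rpow_of_lt (by norm_num) ha]
  · congr 1
    norm_num
    rw [Real.rpow_neg_one]
  · exact (ae_restrict_mem measurableSet_Ioi).mono fun l hl =>
      Real.rpow_nonneg (ha.trans hl).le _

lemma lintegral_inv_sq_mul_min {E : ℝ} (hE : 1 ≤ E) :
    ∫⁻ l in Set.Ioi (1 : ℝ), ENNReal.ofReal (l ^ (-2 : ℝ)) * ENNReal.ofReal (min l E)
      = ENNReal.ofReal (1 + Real.log E) := by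
  have hE0 : 0 < E := by linarith
  rw [← Set.Ioc_union_Ioi_eq_Ioi hE, lintegral_union measurableSet_Ioi
    (Set.Ioc_disjoint_Ioi le_rfl)]
  have h1 : ∫⁻ l in Set.Ioc 1 E, ENNReal.ofReal (l ^ (-2 : ℝ)) * ENNReal.ofReal (min l E)
      = ENNReal.ofReal (Real.log E) := by
    have hi := integral_inv_of_pos one_pos hE0
    rw [intervalIntegral.integral_of_le hE, div_one] at hi
    rw [← hi, ofReal_integral_eq_lintegral_ofReal]
    · refine setLIntegral_congr_fun measurableSet_Ioc fun l hl => ?_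
      have hl0 : 0 < l := one_pos.trans hl.1
      rw [← ENNReal.ofReal_mul (by positivity), min_eq_left hl.2]
      congr 1
      rw [Real.rpow_neg hl0.le, Real.rpow_two]
      field_simp
    · have : IntervalIntegrable (fun x : ℝ => x⁻¹) volume 1 E :=
        intervalIntegral.intervalIntegrable_inv (fun x hx => by
          rw [Set.uIcc_of_le hE] at hx; linarith [hx.1]) continuousOn_id
      exact (intervalIntegrable_iff_integrableOn_Ioc_of_le hE).1 this
    · exact (ae_restrict_mem measurableSet_Ioc).mono fun l hl =>
        inv_nonneg.2 (one_pos.trans hl.1).le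
  have h2 : ∫⁻ l in Set.Ioi E, ENNReal.ofReal (l ^ (-2 : ℝ)) * ENNReal.ofReal (min l E) = 1 := by
    rw [setLIntegral_congr_fun (g := fun l => ENNReal.ofReal (l ^ (-2 : ℝ)) * ENNReal.ofReal E)
      measurableSet_Ioi fun l hl => by rw [min_eq_right (Set.mem_Ioi.1 hl).le],
      lintegral_mul_const _ (by fun_prop), lintegral_inv_sq_Ioi hE0,
      ← ENNReal.ofReal_mul (by positivity), inv_mul_cancel₀ hE0.ne', ENNReal.ofReal_one]
  rw [h1, h2, add_comm, ENNReal.ofReal_add zero_le_one (Real.log_nonneg hE), ENNReal.ofReal_one]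

/-- The indicator is on once `l ≥ T / q`, so the integral is at least `T / max 1 (T / q)`, which is
`min T q`. This expresses a truncated tail through tails cut off at quantiles. -/
lemma min_le_lintegral {T : ℝ≥0∞} (hT : T ≤ 1) {q : ℝ} (hq : 0 < q) :
    min T (ENNReal.ofReal q) ≤ ∫⁻ l in Set.Ioi (1 : ℝ),
      ENNReal.ofReal (l ^ (-2 : ℝ)) * (if T ≤ ENNReal.ofReal (l * q) then T else 0) := by
  obtain ⟨τ, rfl⟩ : ∃ τ : ℝ≥0, T = τ := ⟨T.toNNReal, by
    rw [ENNReal.coe_toNNReal (ne_top_of_le_ne_top ENNReal.one_ne_top hT)]⟩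
  set a : ℝ := max 1 (τ / q) with ha
  have ha0 : 0 < a := lt_of_lt_of_le one_pos (le_max_left _ _)
  calc min (τ : ℝ≥0∞) (ENNReal.ofReal q) ≤ ENNReal.ofReal (a⁻¹) * τ := by
        rw [← ENNReal.ofReal_coe_nnreal, ← ENNReal.ofReal_mul (by positivity),
          ← ENNReal.ofReal_min]
        refine ENNReal.ofReal_le_ofReal ?_
        rw [inv_mul_eq_div, le_div_iff₀ ha0]
        rcases le_total 1 ((τ : ℝ) / q) with h | h
        · rw [ha, max_eq_right h]
          calc min (τ : ℝ) q * (τ / q) ≤ q * (τ / q) := by gcongr; exact min_le_right _ _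
            _ = τ := by field_simp
        · rw [ha, max_eq_left h, mul_one]
          exact min_le_left _ _
    _ = ∫⁻ l in Set.Ioi a, ENNReal.ofReal (l ^ (-2 : ℝ)) * τ := by
        rw [lintegral_mul_const _ (by fun_prop), lintegral_inv_sq_Ioi ha0]
    _ ≤ ∫⁻ l in Set.Ioi a, ENNReal.ofReal (l ^ (-2 : ℝ))
          * (if (τ : ℝ≥0∞) ≤ ENNReal.ofReal (l * q) then (τ : ℝ≥0∞) else 0) := by
        refine setLIntegral_mono' measurableSet_Ioi fun l hl => ?_
        rw [if_pos]
        rw [← ENNReal.ofReal_coe_nnreal]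
        refine ENNReal.ofReal_le_ofReal ?_
        rw [← div_le_iff₀ hq]
        exact (le_max_right _ _).trans (le_of_lt hl)
    _ ≤ _ := lintegral_mono_set (Set.Ioi_subset_Ioi (le_max_left _ _))

/-! ### The ex-ante relaxation -/

lemma exists_measurable_argmax {n : ℕ} {P : Finset (Finset (Fin n))} (hP : P.Nonempty) :
    ∃ σ : Values n → Finset (Fin n), (∀ v, σ v ∈ P) ∧ (∀ S, MeasurableSet {v | σ v = S}) ∧
      ∀ v, P.sup (fun S => ∑ i ∈ S, v i) = ∑ i ∈ σ v, v i := by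
  induction hP using Finset.Nonempty.cons_induction with
  | singleton S =>
    exact ⟨fun _ => S, by simp, fun T => MeasurableSet.const _, by simp⟩
  | cons S P hS hP ih =>
    obtain ⟨σ, hσP, hσm, hσ⟩ := ih
    have hle : MeasurableSet {v : Values n | P.sup (fun S => ∑ i ∈ S, v i) ≤ ∑ i ∈ S, v i} := by
      have : {v : Values n | P.sup (fun S => ∑ i ∈ S, v i) ≤ ∑ i ∈ S, v i}
          = ⋂ T ∈ P, {v : Values n | ∑ i ∈ T, v i ≤ ∑ i ∈ S, v i} := by
        ext v; simp
      rw [this]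
      exact P.measurableSet_biInter fun T _ => measurableSet_le (by fun_prop) (by fun_prop)
    classical
    refine ⟨fun v => if P.sup (fun S => ∑ i ∈ S, v i) ≤ ∑ i ∈ S, v i then S else σ v,
      fun v => ?_, fun T => ?_, fun v => ?_⟩
    · simp only
      split_ifs
      · exact Finset.mem_cons_self _ _
      · exact Finset.mem_cons_of_mem (hσP v)
    · have : {v : Values n | (if P.sup (fun S => ∑ i ∈ S, v i) ≤ ∑ i ∈ S, v i then S else σ v) = T}
          = ({v | P.sup (fun S => ∑ i ∈ S, v i) ≤ ∑ i ∈ S, v i} ∩ {_v | S = T})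
            ∪ ({v | P.sup (fun S => ∑ i ∈ S, v i) ≤ ∑ i ∈ S, v i}ᶜ ∩ {v | σ v = T}) := by
        ext v
        by_cases h : P.sup (fun S => ∑ i ∈ S, v i) ≤ ∑ i ∈ S, v i <;>
          simp [h, -Finset.sup_le_iff]
      rw [this]
      exact (hle.inter (MeasurableSet.const _)).union (hle.compl.inter (hσm T))
    · rw [Finset.sup_cons]
      simp only
      split_ifs with h
      · exact max_eq_left h
      · rw [← hσ v]
        exact max_eq_right (not_le.1 h).le

/-- Layer cake on `A`: the probability that both `v i > t` and `A` occur is at most that of either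
event. -/
lemma setLIntegral_value_le {n : ℕ} (F : Fin n → ProbabilityMeasure ℝ≥0) (i : Fin n)
    (A : Set (Values n)) :
    ∫⁻ v in A, (v i : ℝ≥0∞) ∂(law F)
      ≤ ∫⁻ t in Set.Ioi (0 : ℝ), min (tail (F i) t) (law F A) := by
  have h := lintegral_eq_lintegral_meas_lt ((law F).restrict A)
    (f := fun v : Values n => (v i : ℝ)) (ae_of_all _ fun _ => NNReal.coe_nonneg _)
    (measurable_pi_apply i).coe_nnreal_real.aemeasurable
  simp only [ENNReal.ofReal_coe_nnreal] at h
  rw [h]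
  refine lintegral_mono fun t => le_min ?_ ?_
  · refine (Measure.restrict_apply_le _ _).trans ?_
    have hm : MeasurableSet {x : ℝ≥0 | t < (x : ℝ)} :=
      measurableSet_lt measurable_const (by fun_prop)
    exact ((measurePreserving_eval (fun i => (F i : Measure ℝ≥0)) i).measure_preimage
      hm.nullMeasurableSet).le
  · exact (measure_mono (Set.subset_univ _)).trans (by simp)

/-- The ex-ante relaxation of the optimal surplus. -/
lemma optSurplus_le {n k : ℕ} (F : Fin n → ProbabilityMeasure ℝ≥0) :
    ∃ q : Fin n → ℝ, (∀ i, 0 ≤ q i ∧ q i ≤ 1) ∧ ∑ i, q i ≤ k ∧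
      optSurplus F (identicalGoods n k)
        ≤ ∑ i, ∫⁻ t in Set.Ioi (0 : ℝ), min (tail (F i) t) (ENNReal.ofReal (q i)) := by
  have hP : (identicalGoods n k).Nonempty := ⟨∅, by simp [identicalGoods]⟩
  obtain ⟨σ, hσP, hσm, hσ⟩ := exists_measurable_argmax hP
  set A : Fin n → Set (Values n) := fun i => {v | i ∈ σ v} with hA
  have hAm : ∀ i, MeasurableSet (A i) := by
    intro i
    have : A i = ⋃ S ∈ {S : Finset (Fin n) | i ∈ S}, {v | σ v = S} := by
      ext v; simp [hA]
    rw [this]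
    exact MeasurableSet.biUnion (Set.to_countable _) fun S _ => hσm S
  -- The witness is the probability that the optimal allocation serves `i`.
  refine ⟨fun i => (law F).real (A i), fun i => ⟨measureReal_nonneg, measureReal_le_one⟩, ?_, ?_⟩
  · have h1 : ∀ i, (law F).real (A i) = ∫ v, (A i).indicator (fun _ => (1 : ℝ)) v ∂(law F) := by
      intro i
      rw [integral_indicator_const _ (hAm i)]
      simp
    have hint : ∀ i, Integrable ((A i).indicator (fun _ => (1 : ℝ))) (law F) := fun i =>
      (integrable_const _).indicator (hAm i)
    simp only [h1]
    rw [← integral_finsetSum _ fun i _ => hint i]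
    calc _ ≤ ∫ _v, (k : ℝ) ∂(law F) := by
          refine integral_mono (integrable_finsetSum _ fun i _ => hint i) (integrable_const _)
            fun v => ?_
          have hc : (σ v).card ≤ k := by simpa [identicalGoods] using hσP v
          have : ∑ i, (A i).indicator (fun _ => (1 : ℝ)) v = (σ v).card := by
            simp [Set.indicator_apply, hA]
          simp only [this]
          exact_mod_cast hc
      _ = k := by simp
  · calc optSurplus F (identicalGoods n k)
        = ∑ i, ∫⁻ v in A i, (v i : ℝ≥0∞) ∂(law F) := by
          unfold optSurplus
          have h1 : ∀ i, ∫⁻ v in A i, (v i : ℝ≥0∞) ∂(law F)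
              = ∫⁻ v, (A i).indicator (fun v => (v i : ℝ≥0∞)) v ∂(law F) := fun i =>
            (lintegral_indicator (hAm i) _).symm
          simp only [h1]
          rw [← lintegral_finsetSum]
          · refine lintegral_congr fun v => ?_
            rw [hσ v]
            simp [Set.indicator_apply, hA, Finset.sum_ite_mem]
          · intro i _
            exact Measurable.indicator (by fun_prop) (hAm i)
      _ ≤ _ := by
          refine Finset.sum_le_sum fun i _ => ?_
          have := setLIntegral_value_le F i (A i)
          rwa [← ofReal_measureReal] at this

/-! ### The bound with a free parameter -/

/-- The `b / Λ` part of the hypothesis cancels the factor `Λ` lost by the mechanism, so `b` escapes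
the logarithm and enters only additively. -/
lemma optSurplus_le_mul {n k : ℕ} (hk : 1 ≤ k) (hkn : k ≤ n) (F : Fin n → ProbabilityMeasure ℝ≥0)
    (hF : ∀ i, Integrable (fun x : ℝ≥0 => (x : ℝ)) (F i : Measure ℝ≥0))
    {ε a b : ℝ} (hε : 0 < ε) (hε1 : ε ≤ 1) (ha : 0 ≤ a) (hb : 0 ≤ b)
    (hab : ∀ Λ : ℝ, 1 ≤ Λ → (soldFraction k Λ)⁻¹ ≤ a + b / Λ) :
    optSurplus F (identicalGoods n k)
      ≤ ENNReal.ofReal ((1 + ((n : ℝ) / k - 1) * ε) * a * (1 - Real.log ε) + b)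
        * optConsumerSurplus F (identicalGoods n k) := by
  have hk0 : (0 : ℝ) < k := by exact_mod_cast hk
  have hkn' : (1 : ℝ) ≤ (n : ℝ) / k := by
    rw [one_le_div hk0]; exact_mod_cast hkn
  obtain ⟨q, hq, hqk, hle⟩ := optSurplus_le (k := k) F
  set O := optConsumerSurplus F (identicalGoods n k) with hO
  set c : ℝ := 1 + ((n : ℝ) / k - 1) * ε with hc
  have hc1 : 1 ≤ c := by
    have := mul_nonneg (sub_nonneg.2 hkn') hε.le
    linarith
  -- Mixing `q` with the constant `1` gives `r i ≥ q i` and `r i ≥ ε` at once, at the price of a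
  -- factor `c` in total demand.
  set r : Fin n → ℝ := fun i => ε + (1 - ε) * q i with hr
  have hrε : ∀ i, ε ≤ r i := fun i => by
    have := mul_nonneg (sub_nonneg.2 hε1) (hq i).1
    simp only [hr]; linarith
  have hqr : ∀ i, q i ≤ r i := fun i => by
    have := mul_nonneg hε.le (sub_nonneg.2 (hq i).2)
    simp only [hr]; linarith
  have hrsum : ∑ i, r i ≤ c * k := by
    have : ∑ i, r i = n * ε + (1 - ε) * ∑ i, q i := by
      simp [hr, Finset.sum_add_distrib, Finset.mul_sum]
    rw [this]
    have h1 : (1 - ε) * ∑ i, q i ≤ (1 - ε) * k :=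
      mul_le_mul_of_nonneg_left hqk (sub_nonneg.2 hε1)
    have h2 : c * k = n * ε + (1 - ε) * k := by
      rw [hc]; field_simp; ring
    linarith
  have hE : 1 ≤ ε⁻¹ := (one_le_inv₀ hε).2 hε1
  set C : Fin n → ℝ≥0∞ → ℝ≥0∞ := fun i s =>
    ∫⁻ t in Set.Ioi (0 : ℝ), (if tail (F i) t ≤ s then tail (F i) t else 0) with hC
  have hoffer : ∀ l : ℝ, 1 ≤ l → ∑ i, C i (ENNReal.ofReal (l * r i))
      ≤ (ENNReal.ofReal (c * a) * ENNReal.ofReal (min l ε⁻¹) + ENNReal.ofReal b) * O := by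
    intro l hl
    set l' := min l ε⁻¹ with hl'
    have hl1 : 1 ≤ l' := le_min hl hE
    have hr0 : ∀ i, 0 < l' * r i := fun i => mul_pos (by linarith) (hε.trans_le (hrε i))
    choose p hp hpC using fun i => exists_price (F i : Measure ℝ≥0)
      (ENNReal.ofReal_pos.2 (hr0 i))
    have hΛ : 1 ≤ l' * c := by nlinarith
    have hsum : ∑ i, (F i : Measure ℝ≥0).real (Set.Ioi (p i)) ≤ l' * c * k := by
      calc _ ≤ ∑ i, l' * r i := Finset.sum_le_sum fun i _ =>
            ENNReal.toReal_le_of_le_ofReal (hr0 i).le (hp i)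
        _ = l' * ∑ i, r i := by rw [Finset.mul_sum]
        _ ≤ l' * (c * k) := by gcongr
        _ = _ := by ring
    -- For `l ≥ ε⁻¹` the capped threshold `ε⁻¹ * r i` is already at least `1`, so it cuts off no
    -- tail.
    have hcap : ∀ i, C i (ENNReal.ofReal (l * r i)) ≤ C i (ENNReal.ofReal (l' * r i)) := by
      intro i
      refine lintegral_mono fun t => ?_
      rcases le_total l ε⁻¹ with h | h
      · rw [hl', min_eq_left h]
      · have : tail (F i) t ≤ ENNReal.ofReal (l' * r i) := by
          refine (tail_le_one _ _).trans (ENNReal.one_le_ofReal.2 ?_)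
          rw [hl', min_eq_right h, inv_mul_eq_div, one_le_div hε]
          exact hrε i
        simp only [this, if_true]
        split_ifs
        · exact le_rfl
        · exact zero_le
    calc ∑ i, C i (ENNReal.ofReal (l * r i))
        ≤ ∑ i, ∫⁻ x, ((x - p i : ℝ≥0) : ℝ≥0∞) ∂(F i : Measure ℝ≥0) :=
          Finset.sum_le_sum fun i _ => (hcap i).trans (hpC i)
      _ ≤ ENNReal.ofReal (l' * c * (soldFraction k (l' * c))⁻¹) * O :=
          soldFraction_mul_le hk F hF p hΛ hsum
      _ ≤ _ := by
          gcongr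
          rw [← ENNReal.ofReal_mul (by positivity), ← ENNReal.ofReal_add (by positivity) hb]
          refine ENNReal.ofReal_le_ofReal ?_
          calc l' * c * (soldFraction k (l' * c))⁻¹ ≤ l' * c * (a + b / (l' * c)) := by
                gcongr; exact hab _ hΛ
            _ = c * a * l' + b := by field_simp
  have hmeas : ∀ i, Measurable (tail (F i)) := fun i => (tail_antitone _).measurable
  have hjoint : ∀ i, Measurable fun z : ℝ × ℝ => ENNReal.ofReal (z.2 ^ (-2 : ℝ))
      * (if tail (F i) z.1 ≤ ENNReal.ofReal (z.2 * r i) then tail (F i) z.1 else 0) := by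
    intro i
    have h1 : Measurable fun z : ℝ × ℝ => tail (F i) z.1 := (hmeas i).comp measurable_fst
    refine Measurable.mul (by fun_prop) (Measurable.ite ?_ h1 measurable_const)
    exact measurableSet_le h1 (by fun_prop)
  have hpull : ∀ i l, ∫⁻ t in Set.Ioi (0 : ℝ), ENNReal.ofReal (l ^ (-2 : ℝ))
      * (if tail (F i) t ≤ ENNReal.ofReal (l * r i) then tail (F i) t else 0)
      = ENNReal.ofReal (l ^ (-2 : ℝ)) * C i (ENNReal.ofReal (l * r i)) := by
    intro i l
    rw [lintegral_const_mul]
    exact Measurable.ite (measurableSet_le (hmeas i) measurable_const) (hmeas i) measurable_const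
  calc optSurplus F (identicalGoods n k)
      ≤ ∑ i, ∫⁻ t in Set.Ioi (0 : ℝ), min (tail (F i) t) (ENNReal.ofReal (q i)) := hle
    _ ≤ ∑ i, ∫⁻ t in Set.Ioi (0 : ℝ), ∫⁻ l in Set.Ioi (1 : ℝ), ENNReal.ofReal (l ^ (-2 : ℝ))
          * (if tail (F i) t ≤ ENNReal.ofReal (l * r i) then tail (F i) t else 0) := by
        refine Finset.sum_le_sum fun i _ => lintegral_mono fun t => ?_
        refine le_trans ?_ (min_le_lintegral (tail_le_one _ _) (hε.trans_le (hrε i)))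
        exact min_le_min le_rfl (ENNReal.ofReal_le_ofReal (hqr i))
    _ = ∑ i, ∫⁻ l in Set.Ioi (1 : ℝ), ENNReal.ofReal (l ^ (-2 : ℝ))
          * C i (ENNReal.ofReal (l * r i)) := by
        refine Finset.sum_congr rfl fun i _ => ?_
        rw [lintegral_lintegral_swap (hjoint i).aemeasurable]
        exact lintegral_congr fun l => hpull i l
    _ = ∫⁻ l in Set.Ioi (1 : ℝ), ENNReal.ofReal (l ^ (-2 : ℝ))
          * ∑ i, C i (ENNReal.ofReal (l * r i)) := by
        rw [← lintegral_finsetSum]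
        · simp only [Finset.mul_sum]
        · intro i _
          have h := (hjoint i).lintegral_prod_left' (μ := volume.restrict (Set.Ioi (0 : ℝ)))
          simpa only [hpull] using h
    _ ≤ ∫⁻ l in Set.Ioi (1 : ℝ), (ENNReal.ofReal (c * a) * (ENNReal.ofReal (l ^ (-2 : ℝ))
          * ENNReal.ofReal (min l ε⁻¹)) + ENNReal.ofReal b * ENNReal.ofReal (l ^ (-2 : ℝ))) * O := by
        refine setLIntegral_mono' measurableSet_Ioi fun l hl => ?_
        calc _ ≤ ENNReal.ofReal (l ^ (-2 : ℝ)) * ((ENNReal.ofReal (c * a)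
              * ENNReal.ofReal (min l ε⁻¹) + ENNReal.ofReal b) * O) := by
              gcongr; exact hoffer l (le_of_lt hl)
          _ = _ := by ring
    _ = ENNReal.ofReal (c * a * (1 - Real.log ε) + b) * O := by
        rw [lintegral_mul_const _ (by fun_prop), lintegral_add_left (by fun_prop),
          lintegral_const_mul _ (by fun_prop), lintegral_const_mul _ (by fun_prop),
          lintegral_inv_sq_mul_min hE, lintegral_inv_sq_Ioi one_pos, inv_one, ENNReal.ofReal_one,
          mul_one, Real.log_inv, ← sub_eq_add_neg, ← ENNReal.ofReal_mul (by positivity),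
          ← ENNReal.ofReal_add _ hb]
        have := Real.log_nonpos hε.le hε1
        have : 0 ≤ 1 - Real.log ε := by linarith
        positivity

/-! ### Choice of the parameters and asymptotics -/

lemma zeta_le {n k : ℕ} (hk : 1 ≤ k) (hkn : k ≤ n) {ε a b : ℝ} (hε : 0 < ε) (hε1 : ε ≤ 1)
    (ha : 0 ≤ a) (hb : 0 ≤ b)
    (hab : ∀ Λ : ℝ, 1 ≤ Λ → (soldFraction k Λ)⁻¹ ≤ a + b / Λ) :
    zeta n k ≤ ENNReal.ofReal ((1 + ((n : ℝ) / k - 1) * ε) * a * (1 - Real.log ε) + b) :=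
  iSup₂_le fun F hF => ENNReal.div_le_of_le_mul
    (optSurplus_le_mul hk hkn F hF hε hε1 ha hb hab)

lemma zeta_le_stirling {n k : ℕ} (hk : 1 ≤ k) (hkn : k ≤ n) {ε : ℝ} (hε : 0 < ε) (hε1 : ε ≤ 1) :
    zeta n k ≤ ENNReal.ofReal
      (1 / (1 - 1 / Real.sqrt (2 * Real.pi * (k : ℝ))) * (1 - Real.log ε)
        * (1 + ((n : ℝ) / (k : ℝ) - 1) * ε)) := by
  have hβ := half_le_stirling hk
  set β : ℝ := 1 - 1 / Real.sqrt (2 * Real.pi * (k : ℝ)) with hβd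
  have hβ0 : 0 < β := by linarith
  refine (zeta_le (a := β⁻¹) (b := 0) hk hkn hε hε1 (by positivity) le_rfl fun Λ hΛ => ?_).trans
    (ENNReal.ofReal_le_ofReal (le_of_eq (by ring)))
  rw [zero_div, add_zero]
  exact inv_anti₀ hβ0 (stirling_le_soldFraction hk hΛ)

/-- For `k = o(n)` the number of goods may stay bounded, and the Stirling factor need not tend to
`1`. Here the leading coefficient is `1`, at an additive cost of `2`. -/
lemma zeta_le_uniform {n k : ℕ} (hk : 1 ≤ k) (hkn : k ≤ n) {ε : ℝ} (hε : 0 < ε) (hε1 : ε ≤ 1) :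
    zeta n k ≤ ENNReal.ofReal ((1 + ((n : ℝ) / k - 1) * ε) * (1 - Real.log ε) + 2) :=
  (zeta_le (a := 1) (b := 2) hk hkn hε hε1 zero_le_one zero_le_two
    fun _ hΛ => inv_soldFraction_le hk hΛ).trans
    (ENNReal.ofReal_le_ofReal (le_of_eq (by ring)))

lemma zeta_le_log {n k : ℕ} (hk : 1 ≤ k) (h : Real.exp 1 ≤ (n : ℝ) / k) :
    zeta n k ≤ ENNReal.ofReal
      ((1 + (Real.log ((n : ℝ) / k))⁻¹) * (1 + Real.log ((n : ℝ) / k)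
        + Real.log (Real.log ((n : ℝ) / k))) + 2) := by
  have hk0 : (0 : ℝ) < k := by exact_mod_cast hk
  set r : ℝ := (n : ℝ) / k with hr
  have hr1 : 1 ≤ r := by linarith [Real.add_one_le_exp (1 : ℝ)]
  have hkn : k ≤ n := by
    have : (k : ℝ) ≤ n := by rwa [hr, one_le_div hk0] at hr1
    exact_mod_cast this
  have hL : 1 ≤ Real.log r := by
    rw [Real.le_log_iff_exp_le (by linarith)]
    exact h
  have hr0 : 0 < r := by linarith
  have hL0 : 0 < Real.log r := by linarith
  -- Slightly below `1 / r`: then `(r - 1) * ε` tends to `0`, while `-log ε` exceeds `log r` only by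
  -- `log (log r)`.
  set ε : ℝ := (r * Real.log r)⁻¹ with hε
  have hε0 : 0 < ε := by positivity
  have hε1 : ε ≤ 1 := inv_le_one_of_one_le₀ (by nlinarith)
  refine (zeta_le_uniform hk hkn hε0 hε1).trans (ENNReal.ofReal_le_ofReal ?_)
  have e1 : 1 - Real.log ε = 1 + Real.log r + Real.log (Real.log r) := by
    rw [hε, Real.log_inv, Real.log_mul hr0.ne' hL0.ne']; ring
  have e2 : 1 + (r - 1) * ε ≤ 1 + (Real.log r)⁻¹ := by
    have : r * ε = (Real.log r)⁻¹ := by rw [hε]; field_simp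
    linarith
  have e3 : 0 ≤ 1 + Real.log r + Real.log (Real.log r) := by
    linarith [Real.log_nonneg hL]
  rw [← hr, e1]
  gcongr

lemma zeta_le_of_isLittleO (k : ℕ → ℕ) (hk : ∀ᶠ n in atTop, 1 ≤ k n)
    (ho : (fun n : ℕ => (k n : ℝ)) =o[atTop] (fun n : ℕ => (n : ℝ))) :
    ∃ δ : ℕ → ℝ, Tendsto δ atTop (𝓝 0) ∧ ∀ᶠ n : ℕ in atTop,
      zeta n (k n) ≤ ENNReal.ofReal ((1 + δ n) * Real.log ((n : ℝ) / (k n : ℝ))) := by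
  have hr : Tendsto (fun n : ℕ => (n : ℝ) / (k n : ℝ)) atTop atTop := by
    have h0 := ho.tendsto_div_nhds_zero
    have h1 : ∀ᶠ n : ℕ in atTop, (0 : ℝ) < (k n : ℝ) / n := by
      filter_upwards [hk, eventually_gt_atTop 0] with n h1 h2
      have : (0 : ℝ) < k n := by exact_mod_cast h1
      positivity
    have h2 := tendsto_inv_nhdsGT_zero.comp
      (tendsto_nhdsWithin_iff.2 ⟨h0, h1⟩)
    refine h2.congr fun n => ?_
    simp
  set L : ℕ → ℝ := fun n => Real.log ((n : ℝ) / (k n : ℝ)) with hL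
  have hLt : Tendsto L atTop atTop := Real.tendsto_log_atTop.comp hr
  refine ⟨fun n => ((1 + (L n)⁻¹) * (1 + L n + Real.log (L n)) + 2) / L n - 1, ?_, ?_⟩
  · have h1 : Tendsto (fun n => (L n)⁻¹) atTop (𝓝 0) := tendsto_inv_atTop_zero.comp hLt
    have h2 : Tendsto (fun n => Real.log (L n) / L n) atTop (𝓝 0) := by
      have := (Real.isLittleO_log_id_atTop.tendsto_div_nhds_zero).comp hLt
      exact this
    have h3 : Tendsto (fun n => (1 + (L n)⁻¹) * ((L n)⁻¹ + 1 + Real.log (L n) / L n)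
        + 2 * (L n)⁻¹ - 1) atTop (𝓝 ((1 + 0) * (0 + 1 + 0) + 2 * 0 - 1)) :=
      ((((h1.const_add 1).mul ((h1.add_const 1).add h2)).add (h1.const_mul 2)).sub_const 1)
    have h4 : ((1 + 0) * (0 + 1 + 0) + 2 * 0 - 1 : ℝ) = 0 := by norm_num
    rw [h4] at h3
    refine h3.congr' ?_
    filter_upwards [hLt.eventually_gt_atTop 0] with n hn
    field_simp
  · filter_upwards [hk, hr.eventually_ge_atTop (Real.exp 1), hLt.eventually_gt_atTop 0]
      with n hn hrn hLn
    refine (zeta_le_log hn hrn).trans (ENNReal.ofReal_le_ofReal (le_of_eq ?_))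
    change _ = (1 + _) * L n
    simp only [add_sub_cancel]
    rw [div_mul_cancel₀ _ hLn.ne']

/-- Optimizing `ε` in the bound `(1 - log ε) * (1 + (r - 1) * ε)`. -/
lemma exists_eps {r : ℝ} (hr : 1 ≤ r) : ∃ ε : ℝ, 0 < ε ∧ ε ≤ 1 ∧
    (1 - Real.log ε) * (1 + (r - 1) * ε) ≤ 2.27 * (0.577 + Real.log r) := by
  have hr0 : 0 < r := by linarith
  have l2 := Real.log_two_gt_d9
  have l2' := Real.log_two_lt_d9
  have l4 : Real.log 4 = 2 * Real.log 2 := by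
    rw [show (4 : ℝ) = 2 ^ 2 by norm_num, Real.log_pow]; norm_num
  -- For `r ≤ 4` take `ε = 1` and bound `log` below by its chord over `[1, 4]`. For `r ≥ 4` take `ε
  -- = 1 / (2 (r - 1))`, which makes the second factor `3/2`, below `2.27`; the tangent of `log` at
  -- `4 / r = 1` settles the constants.
  rcases le_total r 4 with h4 | h4
  · refine ⟨1, one_pos, le_rfl, ?_⟩
    have hc := strictConcaveOn_log_Ioi.concaveOn.2 (Set.mem_Ioi.2 one_pos)
      (Set.mem_Ioi.2 (by norm_num : (0 : ℝ) < 4)) (by linarith : 0 ≤ (4 - r) / 3)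
      (by linarith : 0 ≤ (r - 1) / 3) (by ring)
    have e : (4 - r) / 3 * 1 + (r - 1) / 3 * 4 = r := by ring
    simp only [smul_eq_mul, Real.log_one, mul_zero, zero_add, l4] at hc
    rw [e] at hc
    rw [Real.log_one]
    nlinarith
  · refine ⟨1 / (2 * (r - 1)), one_div_pos.2 (by linarith), ?_, ?_⟩
    · rw [div_le_one (by linarith)]; linarith
    · have h1 : 0 < r - 1 := by linarith
      have e1 : (r - 1) * (1 / (2 * (r - 1))) = 1 / 2 := by field_simp
      rw [e1, one_div, Real.log_inv, Real.log_mul two_ne_zero h1.ne']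
      have e2 : Real.log (r - 1) = Real.log r + Real.log (1 - 1 / r) := by
        rw [← Real.log_mul hr0.ne' (by
          have : 1 / r < 1 := by rw [div_lt_one hr0]; linarith
          linarith)]
        congr 1
        field_simp
      have e3 : Real.log (1 - 1 / r) ≤ -(1 / r) := by
        have h5 : 1 / r < 1 := by rw [div_lt_one hr0]; linarith
        linarith [Real.log_le_sub_one_of_pos (by linarith : 0 < 1 - 1 / r)]
      have e4 : Real.log 4 + (1 - 4 * (1 / r)) ≤ Real.log r := by
        have h5 := Real.log_le_sub_one_of_pos (by positivity : 0 < 4 / r)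
        rw [Real.log_div (by norm_num) hr0.ne'] at h5
        have : 4 / r = 4 * (1 / r) := by ring
        linarith
      have e5 : 1 / r ≤ 1 / 4 := by gcongr
      rw [l4] at e4
      linarith

/-- Here `k n → ∞`, so the Stirling factor tends to `1` and serves as `1 + δ n`; `exists_eps` bounds
the rest. -/
lemma zeta_le_of_isTheta (k : ℕ → ℕ) (hk : ∀ᶠ n in atTop, 1 ≤ k n ∧ k n ≤ n)
    (hθ : (fun n : ℕ => (k n : ℝ)) =Θ[atTop] (fun n : ℕ => (n : ℝ))) :
    ∃ δ : ℕ → ℝ, Tendsto δ atTop (𝓝 0) ∧ ∀ᶠ n : ℕ in atTop,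
      zeta n (k n) ≤ ENNReal.ofReal
        (2.27 * (1 + δ n) * (0.577 + Real.log ((n : ℝ) / (k n : ℝ)))) := by
  have hkt : Tendsto (fun n : ℕ => (k n : ℝ)) atTop atTop := by
    have h1 : Tendsto (fun n : ℕ => ‖(n : ℝ)‖) atTop atTop :=
      tendsto_norm_atTop_atTop.comp tendsto_natCast_atTop_atTop
    have h2 := hθ.tendsto_norm_atTop_iff.2 h1
    simpa [Function.comp_def] using h2
  refine ⟨fun n => 1 / (1 - 1 / Real.sqrt (2 * Real.pi * (k n : ℝ))) - 1, ?_, ?_⟩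
  · have h1 : Tendsto (fun n => 1 / Real.sqrt (2 * Real.pi * (k n : ℝ))) atTop (𝓝 0) := by
      simp only [one_div]
      exact tendsto_inv_atTop_zero.comp
        (Real.tendsto_sqrt_atTop.comp (hkt.const_mul_atTop (by positivity)))
    have h2 := (tendsto_const_nhds (x := (1 : ℝ))).div (h1.const_sub 1) (by norm_num)
    simpa using h2.sub_const 1
  · filter_upwards [hk] with n hn
    have hk0 : (0 : ℝ) < k n := by exact_mod_cast hn.1
    have hr : 1 ≤ (n : ℝ) / (k n : ℝ) := by
      rw [one_le_div hk0]; exact_mod_cast hn.2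
    obtain ⟨ε, hε, hε1, h⟩ := exists_eps hr
    refine (zeta_le_stirling hn.1 hn.2 hε hε1).trans (ENNReal.ofReal_le_ofReal ?_)
    have hβ := half_le_stirling hn.1
    calc _ ≤ 1 / (1 - 1 / Real.sqrt (2 * Real.pi * (k n : ℝ)))
          * (2.27 * (0.577 + Real.log ((n : ℝ) / (k n : ℝ)))) := by
          rw [mul_assoc]
          exact mul_le_mul_of_nonneg_left h (one_div_nonneg.2 (le_trans (by norm_num) hβ))
      _ = _ := by ring

end Auction

theorem mainTheorem4 :
    (∀ (n k : ℕ) (ε : ℝ), 1 ≤ k → k ≤ n → 0 < ε → ε ≤ 1 →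
      Auction.zeta n k ≤ ENNReal.ofReal
        (1 / (1 - 1 / Real.sqrt (2 * Real.pi * (k : ℝ))) * (1 - Real.log ε)
          * (1 + ((n : ℝ) / (k : ℝ) - 1) * ε))) ∧
    (∀ k : ℕ → ℕ, (∀ᶠ n in atTop, 1 ≤ k n) →
      (fun n : ℕ => (k n : ℝ)) =o[atTop] (fun n : ℕ => (n : ℝ)) →
      ∃ δ : ℕ → ℝ, Tendsto δ atTop (𝓝 0) ∧ ∀ᶠ n : ℕ in atTop,
        Auction.zeta n (k n) ≤ ENNReal.ofReal
          ((1 + δ n) * Real.log ((n : ℝ) / (k n : ℝ)))) ∧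
    (∀ k : ℕ → ℕ, (∀ᶠ n in atTop, 1 ≤ k n ∧ k n ≤ n) →
      (fun n : ℕ => (k n : ℝ)) =Θ[atTop] (fun n : ℕ => (n : ℝ)) →
      ∃ δ : ℕ → ℝ, Tendsto δ atTop (𝓝 0) ∧ ∀ᶠ n : ℕ in atTop,
        Auction.zeta n (k n) ≤ ENNReal.ofReal
          (2.27 * (1 + δ n) * (0.577 + Real.log ((n : ℝ) / (k n : ℝ))))) :=
  ⟨fun _ _ _ hk hkn hε hε1 => Auction.zeta_le_stirling hk hkn hε hε1,
    Auction.zeta_le_of_isLittleO, Auction.zeta_le_of_isTheta⟩
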